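/- **Setting.** Let $J,N,N_p$ be the numbers of scalar unknowns, observations and particles per unknown, and $B\ge 1$ the batch size. Given measurement functions $f_n:\mathbb R^J\to\mathbb C$, data $r_n\in\mathbb C$ and a noise level $\eta>0$, let $$p(r\mid\theta)=\prod_{n=1}^N\frac1{\sqrt{2\pi}\,\eta}\exp\Big(-\frac{|r_n-f_n(\theta)|^2}{2\eta^2}\Big),\qquad p(\theta)=\prod_{j=1}^J p_j(\theta_j)$$ be the likelihood and the (independent) prior. Let $I_j=[\hat\theta_j-\Delta_j/2,\hat\theta_j+\Delta_j/2]$ and $\epsilon>0$. Assume that $p_j>0$ on $I_j$, and that $\ln p_j$ on $I_j$ and $\ln p(r\mid\cdot)$ on $\prod_j I_j$ are differentiable with Lipschitz continuous gradient (derivatives being taken within these sets). **Problem $\mathcal P_2$.** For positions $\mathbf p=(p_{j,n})$ and weights $\mathbf w=(w_{j,n})$, $1\le j\le J$, $1\le n\le N_p$, let $q(\cdot;\mathbf p,\mathbf w)=\prod_{j}\sum_{n}w_{j,n}\delta_{p_{j,n}}$. Minimize $$L(\mathbf p,\mathbf w)=\int q\ln\frac{q}{p(r\mid\theta)p(\theta)}\,d\theta:=\sum_{n_1,\dots,n_J}\tilde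 w\,\ln\frac{\tilde w}{p(r\mid\tilde{\mathbf p})\,p(\tilde{\mathbf p})},\quad \tilde w=\prod_j w_{j,n_j},\ \ \tilde{\mathbf p}=(p_{1,n_1},\dots,p_{J,n_J}),$$ subject to $p_{j,n}\in I_j$, $\epsilon\le w_{j,n}\le1$ and $\sum_n w_{j,n}=1$ for all $j,n$. A feasible $x^*=(\mathbf p^*,\mathbf w^*)$ is *stationary* if $L$ is differentiable at $x^*$ within the feasible set and its derivative in the direction $x-x^*$ is nonnegative for every feasible $x$. **Algorithm.** Start from a (possibly random) feasible point $(\mathbf p^{(0)},\mathbf w^{(0)})$ and from $\mathrm f^{(-1)}_{p_j}=\mathrm f^{(-1)}_{w_j}=0$. In iteration $t=0,1,\dots$, draw, conditionally on the past, i.i.d. samples $\theta^{(1)},\dots,\theta^{(B)}$ from $q(\cdot;\mathbf p^{(t)},\mathbf w^{(t)})$. In parallel for all $j$, set $$\mathrm f^{(t)}_{p_j}=(1-\rho^{(t)})\mathrm f^{(t-1)}_{p_j}+\frac{\rho^{(t)}}B\sum_{b=1}^B\Big(-w^{(t)}_{j,n}\,\partial_{p_{j,n}}\big[\ln p_j(p^{(t)}_{j,n})+\ln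 p(r\mid p^{(t)}_{j,n},\theta^{(b)}_{\sim j})\big]\Big)_{n},$$ $$\mathrm f^{(t)}_{w_j}=(1-\rho^{(t)})\mathrm f^{(t-1)}_{w_j}+\frac{\rho^{(t)}}B\sum_{b=1}^B\Big(\ln w^{(t)}_{j,n}+1-\ln p_j(p^{(t)}_{j,n})-\ln p(r\mid p^{(t)}_{j,n},\theta^{(b)}_{\sim j})\Big)_{n},$$ where $(s,\theta_{\sim j})$ denotes $\theta$ with its $j$-th entry replaced by $s$. Let $\bar{\mathbf p}^{(t)}_j$ and $\bar{\mathbf w}^{(t)}_j$ be the Euclidean projections of $\mathbf p^{(t)}_j-\Gamma^{(t)}_{p_j}\mathrm f^{(t)}_{p_j}$ and $\mathbf w^{(t)}_j-\Gamma^{(t)}_{w_j}\mathrm f^{(t)}_{w_j}$ onto the feasible sets of the positions and of the weights of the $j$-th unknown, and put $$\mathbf p^{(t+1)}_j=(1-\gamma^{(t)})\mathbf p^{(t)}_j+\gamma^{(t)}\bar{\mathbf p}^{(t)}_j,\qquad \mathbf w^{(t+1)}_j=(1-\gamma^{(t)})\mathbf w^{(t)}_j+\gamma^{(t)}\bar{\mathbf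 w}^{(t)}_j .$$ **Theorem.** Suppose that $\rho^{(t)}>0$, $\rho^{(t)}\to0$, $\sum_t\rho^{(t)}=\infty$, $\sum_t(\rho^{(t)})^2<\infty$; that $0\le\gamma^{(t)}\le1$, $\sum_t\gamma^{(t)}=\infty$ and $\gamma^{(t)}/\rho^{(t)}\to0$; and that $\Gamma_{\min}\le\Gamma^{(t)}_{p_j},\Gamma^{(t)}_{w_j}\le\Gamma_{\max}$ for all $t,j$, with constants $0<\Gamma_{\min}\le\Gamma_{\max}<\infty$. Then, almost surely, every limit point $(\mathbf p^*,\mathbf w^*)$ of $(\mathbf p^{(t)},\mathbf w^{(t)})_{t}$ is a stationary point of $\mathcal P_2$. -/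

import Mathlib

open MeasureTheory Filter Topology
open scoped NNReal

noncomputable section

namespace PSPVBI

/-- A family `x j n` of scalars, one for every variable `j` and every particle `n`
(positions, weights, or the corresponding gradient estimates). -/
abbrev Particles (J Np : ℕ) : Type := Fin J → Fin Np → ℝ

/-- The data of the estimation problem with `J` scalar unknowns and `N` complex observations
`r n = f n θ + noise`: measurement functions, observed data, noise level, prior densities of the
(independent) unknowns, centres and widths of the search intervals, lower bound on the weights. -/
structure Model (J N : ℕ) where
  f : Fin N → (Fin J → ℝ) → ℂ
  r : Fin N → ℂ
  η : ℝ
  prior : Fin J → ℝ → ℝ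
  center : Fin J → ℝ
  width : Fin J → ℝ
  ε : ℝ

namespace Model

variable {J N Np B : ℕ} (M : Model J N)

/-- The likelihood `p(r | θ)` of the observed data under white Gaussian noise. -/
def lik (θ : Fin J → ℝ) : ℝ :=
  ∏ n, (1 / (Real.sqrt (2 * Real.pi) * M.η)) *
    Real.exp (-(‖M.r n - M.f n θ‖ ^ 2 / (2 * M.η ^ 2)))

/-- The joint prior density `p(θ) = ∏ j, p(θ j)`. -/
def jointPrior (θ : Fin J → ℝ) : ℝ := ∏ j, M.prior j (θ j)

/-- The search interval of the `j`-th unknown. -/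
def interval (j : Fin J) : Set ℝ :=
  Set.Icc (M.center j - M.width j / 2) (M.center j + M.width j / 2)

/-- The search box of the vector of unknowns. -/
def box : Set (Fin J → ℝ) := {θ | ∀ j, θ j ∈ M.interval j}

/-- Admissible positions of the particles of the `j`-th unknown. -/
def posSet (Np : ℕ) (j : Fin J) : Set (Fin Np → ℝ) := {x | ∀ n, x n ∈ M.interval j}

/-- Admissible weights of the particles of one unknown. -/
def weightSet (Np : ℕ) : Set (Fin Np → ℝ) :=
  {v | ∑ n, v n = 1 ∧ ∀ n, M.ε ≤ v n ∧ v n ≤ 1}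

/-- The feasible set of the particle problem. -/
def feasible (Np : ℕ) : Set (Particles J Np × Particles J Np) :=
  {x | ∀ j, x.1 j ∈ M.posSet Np j ∧ x.2 j ∈ M.weightSet Np}

/-- The objective `∫ q ln (q / (p(r|θ) p(θ)))` for the mean-field particle distribution
`q = ∏ j, ∑ n, w j n • δ (p j n)`: the joint particle selected by `ν` sits at
`(p j (ν j))_j` and carries the mass `∏ j, w j (ν j)`. -/
def objective (x : Particles J Np × Particles J Np) : ℝ :=
  ∑ ν : Fin J → Fin Np, (∏ j, x.2 j (ν j)) *
    Real.log ((∏ j, x.2 j (ν j)) /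
      (M.lik (fun j => x.1 j (ν j)) * M.jointPrior (fun j => x.1 j (ν j))))

/-- First-order stationarity for minimizing the objective over the (convex) feasible set.
The value `D (y - x)` is the one-sided directional derivative, so it does not depend on the
choice of the derivative `D` within the feasible set. -/
def IsStationary (x : Particles J Np × Particles J Np) : Prop :=
  x ∈ M.feasible Np ∧
    ∃ D : (Particles J Np × Particles J Np) →L[ℝ] ℝ,
      HasFDerivWithinAt M.objective D (M.feasible Np) x ∧
        ∀ y ∈ M.feasible Np, 0 ≤ D (y - x)

/-- The instantaneous gradient with respect to the position `p j n` at the sample `θ`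
(only the coordinates of `θ` other than the `j`-th matter). Derivatives are taken within the
search interval, so they are one-sided at its end points. -/
def gradP (p w : Particles J Np) (θ : Fin J → ℝ) (j : Fin J) (n : Fin Np) : ℝ :=
  -(w j n) * derivWithin
    (fun s => Real.log (M.prior j s) + Real.log (M.lik (Function.update θ j s)))
    (M.interval j) (p j n)

/-- The instantaneous gradient with respect to the weight `w j n` at the sample `θ`. -/
def gradW (p w : Particles J Np) (θ : Fin J → ℝ) (j : Fin J) (n : Fin Np) : ℝ :=
  Real.log (w j n) + 1 - Real.log (M.prior j (p j n))
    - Real.log (M.lik (Function.update θ j (p j n)))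

end Model

/-- The variational distribution `∏ j, ∑ n, w j n • δ (p j n)` on `ℝ^J`. -/
def particleLaw {J Np : ℕ} (p w : Particles J Np) : Measure (Fin J → ℝ) :=
  Measure.pi fun j => ∑ n, ENNReal.ofReal (w j n) • Measure.dirac (p j n)

/-- `y` is the Euclidean projection of `x` onto `S`. -/
def IsProj {n : ℕ} (S : Set (Fin n → ℝ)) (x y : Fin n → ℝ) : Prop :=
  y ∈ S ∧ ∀ z ∈ S, ∑ i, (x i - y i) ^ 2 ≤ ∑ i, (x i - z i) ^ 2

/-- `φ` is differentiable within `S`, with a Lipschitz continuous derivative on `S`. -/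
def LipschitzGradientOn {E F : Type*} [NormedAddCommGroup E] [NormedSpace ℝ E]
    [NormedAddCommGroup F] [NormedSpace ℝ F] (φ : E → F) (S : Set E) : Prop :=
  ∃ (φ' : E → E →L[ℝ] F) (K : ℝ≥0),
    (∀ x ∈ S, HasFDerivWithinAt φ (φ' x) S x) ∧ LipschitzOnWith K φ' S

/-- Standing assumptions: positive noise level and weight bound; the priors are positive on the
search intervals; log-priors and log-likelihood have Lipschitz gradients on the search region. -/
structure Model.Regular {J N : ℕ} (M : Model J N) : Prop where
  noise_pos : 0 < M.η
  eps_pos : 0 < M.ε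
  prior_pos : ∀ j, ∀ s ∈ M.interval j, 0 < M.prior j s
  log_prior : ∀ j, LipschitzGradientOn (fun s => Real.log (M.prior j s)) (M.interval j)
  log_lik : LipschitzGradientOn (fun θ => Real.log (M.lik θ)) M.box

/-- The step-size rules for the gradient averaging (`ρ`) and the iterate averaging (`γ`). -/
structure StepRules (ρ γ : ℕ → ℝ) : Prop where
  rho_pos : ∀ t, 0 < ρ t
  rho_tendsto : Tendsto ρ atTop (𝓝 0)
  rho_sum : ¬ Summable ρ
  rho_sq_sum : Summable fun t => ρ t ^ 2
  gamma_mem : ∀ t, γ t ∈ Set.Icc (0 : ℝ) 1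
  gamma_sum : ¬ Summable γ
  ratio_tendsto : Tendsto (fun t => γ t / ρ t) atTop (𝓝 0)

/-- `p, w` are the iterates of the parallel stochastic particle algorithm from a feasible
starting point. `ℱ t` is the information available before the `t`-th mini-batch
`θ t · b`, `b : Fin B`, is drawn; given it, the batch is i.i.d. with the current particle
distribution. `fp (t + 1)`, `fw (t + 1)` are the averaged gradients formed in iteration `t`
(so that `fp 0 = 0`, `fw 0 = 0` are their values before iteration `0`), and `pbar t`, `wbar t`
the projected gradient steps; `Γp`, `Γw` are the step lengths of the latter. -/
structure IsRun {J N Np B : ℕ} (M : Model J N) (ρ γ : ℕ → ℝ) (Γp Γw : ℕ → Fin J → ℝ)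
    {Ω : Type*} {mΩ : MeasurableSpace Ω} (μ : Measure Ω) (ℱ : Filtration ℕ mΩ)
    (p w fp fw pbar wbar : ℕ → Ω → Particles J Np)
    (θ : ℕ → Ω → Fin B → Fin J → ℝ) : Prop where
  init : ∀ ω, (p 0 ω, w 0 ω) ∈ M.feasible Np
  adapted_p : ∀ t, Measurable[ℱ t] (p t)
  adapted_w : ∀ t, Measurable[ℱ t] (w t)
  adapted_sample : ∀ t, Measurable[ℱ (t + 1)] (θ t)
  sample_law : ∀ t, ∀ A : Set (Fin B → Fin J → ℝ), MeasurableSet A →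
    μ[(θ t ⁻¹' A).indicator (fun _ => (1 : ℝ)) | ℱ t] =ᵐ[μ]
      fun ω => (Measure.pi fun _ : Fin B => particleLaw (p t ω) (w t ω)).real A
  fp_zero : ∀ ω, fp 0 ω = 0
  fw_zero : ∀ ω, fw 0 ω = 0
  fp_succ : ∀ t ω j n, fp (t + 1) ω j n = (1 - ρ t) * fp t ω j n +
    ρ t / B * ∑ b, M.gradP (p t ω) (w t ω) (θ t ω b) j n
  fw_succ : ∀ t ω j n, fw (t + 1) ω j n = (1 - ρ t) * fw t ω j n +
    ρ t / B * ∑ b, M.gradW (p t ω) (w t ω) (θ t ω b) j n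
  pbar_proj : ∀ t ω j,
    IsProj (M.posSet Np j) (fun n => p t ω j n - Γp t j * fp (t + 1) ω j n) (pbar t ω j)
  wbar_proj : ∀ t ω j,
    IsProj (M.weightSet Np) (fun n => w t ω j n - Γw t j * fw (t + 1) ω j n) (wbar t ω j)
  p_succ : ∀ t ω j n, p (t + 1) ω j n = (1 - γ t) * p t ω j n + γ t * pbar t ω j n
  w_succ : ∀ t ω j n, w (t + 1) ω j n = (1 - γ t) * w t ω j n + γ t * wbar t ω j n

end PSPVBI

end

/-! The algorithm is a projected gradient method whose direction is an exponential average of noisy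
gradients. Write `x t` for the iterate, `f t` for the average before iteration t, `G` for the
gradient of the objective `L` and `xbar t` for the projected point.

Two facts tie it to the objective. On the feasible set, where the weights sum to one, the
expectation of the sampled gradients under the current particle law is exactly the gradient of `L`
(`Regular.hasFDerivWithinAt_objective`). Conditionally on the past, each sample takes finitely many
values with known weights, so the gradient noise has conditional mean zero and is orthogonal to the
past error (`integral_inner_noise`).

The Lyapunov function is the sum of the expectations of `L (x t)` and of the squared tracking error
of `f t`. Averaging contracts the tracking error by a factor of about 1 - ρ per step, at a noise
cost of order ρ ^ 2. The drift of the iterate costs γ ^ 2 / ρ times the squared step, and the wrong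
direction costs γ times the squared direction error. Since γ / ρ tends to 0, both are absorbed
(`summable_of_two_timescale`). By Tonelli, almost surely the squared steps and the squared direction
errors are summable with weights γ.

For a fixed feasible y, the gap ⟪G (x t), x t - y⟫ is at most a constant times the sum of step
length and direction error, and it moves by O(γ t) per iteration. Since γ is not summable, the
positive part of the gap tends to zero along the whole sequence (`tendsto_zero_of_summable_mul_sq`).
Continuity of the gap then gives the first-order condition at every limit point
(`ae_forall_limit_point`).

Regularity (bounded Lipschitz gradient, quadratic upper bound) comes from a calculus of bounded
Lipschitz functions on the compact feasible set. -/

namespace PSPVBI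

/-! ### Deterministic sequences: descent, two time scales, convergence to zero. -/

section RealSequences

/-- If `u` is bounded below and decreases by `h` up to a summable error, then `h` is summable. -/
theorem summable_of_eventually_descent {u h k : ℕ → ℝ} {m : ℝ} (hh : ∀ t, 0 ≤ h t)
    (hk0 : ∀ t, 0 ≤ k t) (hk : Summable k) (hm : ∀ t, m ≤ u t)
    (hu : ∀ᶠ t in atTop, u (t + 1) ≤ u t - h t + k t) : Summable h := by
  obtain ⟨T, hT⟩ := eventually_atTop.1 hu
  rw [← summable_nat_add_iff T]
  have hk' : Summable fun t => k (t + T) := (summable_nat_add_iff T).2 hk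
  have key : ∀ n, ∑ t ∈ Finset.range n, h (t + T)
      ≤ u T - u (n + T) + ∑ t ∈ Finset.range n, k (t + T) := by
    intro n
    induction n with
    | zero => simp
    | succ n ih =>
      rw [Finset.sum_range_succ, Finset.sum_range_succ]
      have h1 := hT (n + T) (by omega)
      rw [show n + 1 + T = n + T + 1 by omega]
      linarith
  refine summable_of_sum_range_le (c := u T - m + ∑' t, k (t + T)) (fun t => hh _) fun n => ?_
  have h1 := hk'.sum_le_tsum (Finset.range n) (fun t _ => hk0 _)
  linarith [key n, hm (n + T)]

/-- A nonnegative sequence whose increments are `O(γ t)` and for which `∑ γ t * r t ^ 2` converges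
while `∑ γ t` diverges tends to zero: the cubes `r t ^ 3` form a Cauchy sequence. -/
theorem tendsto_zero_of_summable_mul_sq {γ r : ℕ → ℝ} {C : ℝ} (hγ : ∀ t, γ t ∈ Set.Icc (0 : ℝ) 1)
    (hγs : ¬ Summable γ) (hγ2 : Summable fun t => γ t ^ 2) (hr : ∀ t, 0 ≤ r t)
    (hinc : ∀ t, |r (t + 1) - r t| ≤ C * γ t) (hs : Summable fun t => γ t * r t ^ 2) :
    Tendsto r atTop (𝓝 0) := by
  -- Cubes are used because their increments carry a factor of order `r ^ 2`: they are controlled by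
  -- `γ * r ^ 2` and `γ ^ 2`, both summable, whereas the increments of `r` are only O(γ).
  have hbound : ∀ t, dist (r t ^ 3) (r (t + 1) ^ 3)
      ≤ 5 * |C| * (γ t * r t ^ 2) + 3 * |C| ^ 3 * γ t ^ 2 := by
    intro t
    obtain ⟨g0, g1⟩ := hγ t
    have hcg : C * γ t ≤ |C| * γ t := mul_le_mul_of_nonneg_right (le_abs_self C) g0
    have h1 : |r (t + 1) - r t| ≤ |C| * γ t := (hinc t).trans hcg
    have h2 : r (t + 1) ^ 2 ≤ 2 * r t ^ 2 + 2 * (|C| * γ t) ^ 2 := by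
      have : (r (t + 1) - r t) ^ 2 ≤ (|C| * γ t) ^ 2 := by
        rw [← sq_abs]; gcongr
      nlinarith [sq_nonneg (r (t + 1) - 2 * r t)]
    have h3 : r (t + 1) ^ 2 + r (t + 1) * r t + r t ^ 2 ≤ 5 * r t ^ 2 + 3 * (|C| * γ t) ^ 2 := by
      nlinarith [sq_nonneg (r (t + 1) - r t)]
    have h30 : 0 ≤ r (t + 1) ^ 2 + r (t + 1) * r t + r t ^ 2 := by
      have := hr t; have := hr (t + 1); positivity
    have h4 : dist (r t ^ 3) (r (t + 1) ^ 3)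
        = |r (t + 1) - r t| * (r (t + 1) ^ 2 + r (t + 1) * r t + r t ^ 2) := by
      rw [dist_comm, Real.dist_eq, ← abs_of_nonneg h30, ← abs_mul]
      congr 1; ring
    rw [h4]
    calc _ ≤ |C| * γ t * (5 * r t ^ 2 + 3 * (|C| * γ t) ^ 2) := by gcongr
      _ = 5 * |C| * (γ t * r t ^ 2) + 3 * |C| ^ 3 * γ t ^ 2 * γ t := by ring
      _ ≤ 5 * |C| * (γ t * r t ^ 2) + 3 * |C| ^ 3 * γ t ^ 2 := by
        exact add_le_add le_rfl (mul_le_of_le_one_right (by positivity) g1)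
  have hcau : CauchySeq fun t => r t ^ 3 := by
    refine cauchySeq_of_summable_dist (Summable.of_nonneg_of_le (fun _ => dist_nonneg) hbound ?_)
    exact (hs.mul_left _).add (hγ2.mul_left _)
  obtain ⟨l, hl⟩ := cauchySeq_tendsto_of_complete hcau
  have hl0 : 0 ≤ l := ge_of_tendsto' hl fun t => pow_nonneg (hr t) 3
  have hr3 : Tendsto r atTop (𝓝 (l ^ (1 / 3 : ℝ))) := by
    have := hl.rpow_const (p := (1 / 3 : ℝ)) (Or.inr (by norm_num))
    refine this.congr fun t => ?_
    rw [← Real.rpow_natCast, ← Real.rpow_mul (hr t)]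
    norm_num
  rcases hl0.eq_or_lt with h0 | h0
  · rwa [← h0, Real.zero_rpow (by norm_num)] at hr3
  -- A positive limit q would give `γ t ≤ (2 / q) ^ 2 * (γ t * r t ^ 2)` eventually, making `γ`
  -- summable.
  · exfalso
    have hq : 0 < l ^ (1 / 3 : ℝ) := Real.rpow_pos_of_pos h0 _
    set q := l ^ (1 / 3 : ℝ)
    have hev : ∀ᶠ t in atTop, q / 2 < r t := hr3.eventually_const_lt (by linarith)
    apply hγs
    have hsum : Summable fun t => (q / 2)⁻¹ ^ 2 * (γ t * r t ^ 2) := hs.mul_left _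
    refine hsum.of_norm_bounded_eventually_nat ?_
    filter_upwards [hev] with t ht
    rw [Real.norm_of_nonneg (hγ t).1]
    have h1 : 1 ≤ (q / 2)⁻¹ * r t := by
      rw [inv_mul_eq_div, one_le_div (by positivity)]; exact ht.le
    calc γ t = γ t * 1 := by ring
      _ ≤ γ t * ((q / 2)⁻¹ * r t) ^ 2 :=
        mul_le_mul_of_nonneg_left (one_le_pow₀ h1) (hγ t).1
      _ = _ := by ring

/-- Two-time-scale descent: `a` is the objective, `b` the squared tracking error, `s` the squared
step and `e` the squared error of the search direction. -/
theorem summable_of_two_timescale {ρ γ : ℕ → ℝ} (hst : StepRules ρ γ) {a b s e : ℕ → ℝ}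
    {m c C : ℝ} (hc : 0 < c) (ha : ∀ t, m ≤ a t) (hb : ∀ t, 0 ≤ b t) (hs : ∀ t, 0 ≤ s t)
    (he0 : ∀ t, 0 ≤ e t)
    (haa : ∀ᶠ t in atTop, a (t + 1) ≤ a t - γ t * (c / 2 * s t) + γ t * (c⁻¹ * e t))
    (he : ∀ t, e t ≤ (1 - ρ t) ^ 2 * b t + ρ t ^ 2 * C ^ 2)
    (hbb : ∀ t, b (t + 1) ≤ (1 + ρ t) * e t + (1 + (ρ t)⁻¹) * (C ^ 2 * γ t ^ 2 * s t)) :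
    Summable (fun t => γ t * s t) ∧ Summable fun t => γ t * e t := by
  have hρ1 : ∀ᶠ t in atTop, ρ t < 1 := hst.rho_tendsto.eventually_lt_const one_pos
  have hq1 : ∀ᶠ t in atTop, γ t / ρ t < c / 2 :=
    hst.ratio_tendsto.eventually_lt_const (by positivity)
  have hq2 : ∀ᶠ t in atTop, 2 * C ^ 2 * (γ t / ρ t) < c / 4 := by
    refine (hst.ratio_tendsto.const_mul (2 * C ^ 2)).eventually_lt_const ?_
    rw [mul_zero]; positivity
  have hsmall : ∀ᶠ t in atTop, γ t * e t ≤ c / 2 * (ρ t * b t + C ^ 2 * ρ t ^ 2) := by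
    filter_upwards [hρ1, hq1] with t h1 h2
    have hρ := hst.rho_pos t
    have hγ := (hst.gamma_mem t).1
    rw [div_lt_iff₀ hρ] at h2
    have hee : e t ≤ b t + ρ t * C ^ 2 := by
      refine (he t).trans (add_le_add ?_ ?_)
      · exact mul_le_of_le_one_left (hb t) (by nlinarith)
      · gcongr; nlinarith
    calc γ t * e t ≤ c / 2 * ρ t * (b t + ρ t * C ^ 2) := by
          gcongr; exact he0 t
      _ = _ := by ring
  -- Budget for the Lyapunov function `a + b`. Descent gains `c / 2 * γ * s`, of which the drift
  -- `e2` uses half. The contraction `(1 + ρ) * (1 - ρ) ^ 2 ≤ 1 - ρ` in `e1` gains `ρ * b`, of which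
  -- the direction error `e3` uses half. What remains of order `ρ ^ 2`, namely `2 * C ^ 2` and `C ^
  -- 2 / 2`, fits into `3 * C ^ 2`.
  have hsum : Summable fun t => c / 4 * (γ t * s t) + 1 / 2 * (ρ t * b t) := by
    refine summable_of_eventually_descent (u := fun t => a t + b t) (m := m)
      (k := fun t => 3 * C ^ 2 * ρ t ^ 2) ?_ (fun t => by positivity)
      (hst.rho_sq_sum.mul_left _) (fun t => by linarith [ha t, hb t]) ?_
    · intro t
      have := hst.rho_pos t; have := (hst.gamma_mem t).1; have := hs t; have := hb t
      positivity
    · filter_upwards [hρ1, hq2, hsmall, haa] with t h1 h2 h3 h4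
      have hρ := hst.rho_pos t
      have hγ := (hst.gamma_mem t).1
      have e1 : (1 + ρ t) * e t ≤ (1 - ρ t) * b t + 2 * C ^ 2 * ρ t ^ 2 := by
        have k1 : (1 + ρ t) * e t ≤ (1 + ρ t) * ((1 - ρ t) ^ 2 * b t + ρ t ^ 2 * C ^ 2) :=
          mul_le_mul_of_nonneg_left (he t) (by linarith)
        have k2 : (1 + ρ t) * (1 - ρ t) ^ 2 * b t ≤ (1 - ρ t) * b t := by
          refine mul_le_mul_of_nonneg_right ?_ (hb t)
          nlinarith [mul_nonneg (sub_nonneg.2 h1.le) (sq_nonneg (ρ t))]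
        have k3 : (1 + ρ t) * (ρ t ^ 2 * C ^ 2) ≤ 2 * (ρ t ^ 2 * C ^ 2) :=
          mul_le_mul_of_nonneg_right (by linarith) (by positivity)
        linarith
      have e2 : (1 + (ρ t)⁻¹) * (C ^ 2 * γ t ^ 2 * s t) ≤ c / 4 * (γ t * s t) := by
        have k1 : 1 + (ρ t)⁻¹ ≤ 2 * (ρ t)⁻¹ := by
          have := (one_le_inv₀ hρ).2 h1.le
          linarith
        have k2 : 0 ≤ γ t * s t := mul_nonneg hγ (hs t)
        calc (1 + (ρ t)⁻¹) * (C ^ 2 * γ t ^ 2 * s t)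
            ≤ 2 * (ρ t)⁻¹ * (C ^ 2 * γ t ^ 2 * s t) := by
              have := hs t
              gcongr
          _ = 2 * C ^ 2 * (γ t / ρ t) * (γ t * s t) := by rw [div_eq_mul_inv]; ring
          _ ≤ _ := mul_le_mul_of_nonneg_right h2.le k2
      have e3 : γ t * (c⁻¹ * e t) ≤ 1 / 2 * (ρ t * b t + C ^ 2 * ρ t ^ 2) := by
        calc γ t * (c⁻¹ * e t) = c⁻¹ * (γ t * e t) := by ring
          _ ≤ c⁻¹ * (c / 2 * (ρ t * b t + C ^ 2 * ρ t ^ 2)) := by gcongr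
          _ = _ := by field_simp
      have e4 := hbb t
      have e5 : 0 ≤ C ^ 2 * ρ t ^ 2 := by positivity
      linarith
  have hpos : ∀ t, 0 ≤ γ t * s t := fun t => mul_nonneg (hst.gamma_mem t).1 (hs t)
  have hpos' : ∀ t, 0 ≤ ρ t * b t := fun t => mul_nonneg (hst.rho_pos t).le (hb t)
  refine ⟨?_, ?_⟩
  · refine Summable.of_nonneg_of_le hpos (fun t => ?_) (hsum.mul_left (4 / c))
    have : 4 / c * (c / 4 * (γ t * s t) + 1 / 2 * (ρ t * b t))
        = γ t * s t + 2 / c * (ρ t * b t) := by field_simp; ring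
    rw [this]
    have := hpos' t
    have : 0 ≤ 2 / c * (ρ t * b t) := by positivity
    linarith
  · have hρb : Summable fun t => ρ t * b t := by
      refine Summable.of_nonneg_of_le hpos' (fun t => ?_) (hsum.mul_left 2)
      have : 0 ≤ c / 4 * (γ t * s t) := mul_nonneg (by positivity) (hpos t)
      linarith
    refine ((hρb.add (hst.rho_sq_sum.mul_left (C ^ 2))).mul_left
      (c / 2)).of_norm_bounded_eventually_nat ?_
    filter_upwards [hsmall] with t ht
    rwa [Real.norm_of_nonneg (mul_nonneg (hst.gamma_mem t).1 (he0 t))]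

theorem StepRules.gamma_sq_summable {ρ γ : ℕ → ℝ} (hst : StepRules ρ γ) :
    Summable fun t => γ t ^ 2 := by
  refine hst.rho_sq_sum.of_norm_bounded_eventually_nat ?_
  filter_upwards [hst.ratio_tendsto.eventually_lt_const one_pos] with t ht
  rw [div_lt_one (hst.rho_pos t)] at ht
  have := (hst.gamma_mem t).1
  rw [Real.norm_of_nonneg (by positivity)]
  gcongr

theorem StepRules.gamma_tendsto {ρ γ : ℕ → ℝ} (hst : StepRules ρ γ) :
    Tendsto γ atTop (𝓝 0) := by
  have := hst.ratio_tendsto.mul hst.rho_tendsto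
  rw [mul_zero] at this
  exact this.congr fun t => div_mul_cancel₀ _ (hst.rho_pos t).ne'

end RealSequences

/-! ### The averaged projected gradient method in a real inner product space. -/

section AveragedGradient

variable {Ω : Type*} {mΩ : MeasurableSpace Ω} {μ : Measure Ω}

/-- By Tonelli the integral of the series is finite, so the series is finite almost everywhere. -/
theorem ae_summable_of_summable_integral {F : ℕ → Ω → ℝ} (h0 : ∀ t ω, 0 ≤ F t ω)
    (hF : ∀ t, Integrable (F t) μ) (hs : Summable fun t => ∫ ω, F t ω ∂μ) :
    ∀ᵐ ω ∂μ, Summable fun t => F t ω := by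
  have h1 : ∫⁻ ω, ∑' t, ENNReal.ofReal (F t ω) ∂μ ≠ ⊤ := by
    rw [lintegral_tsum fun t => (hF t).1.aemeasurable.ennreal_ofReal]
    have : ∀ t, ∫⁻ ω, ENNReal.ofReal (F t ω) ∂μ = ENNReal.ofReal (∫ ω, F t ω ∂μ) := fun t =>
      (ofReal_integral_eq_lintegral_ofReal (hF t) (Eventually.of_forall (h0 t))).symm
    simp_rw [this]
    exact hs.tsum_ofReal_ne_top
  have h2 := ae_lt_top' (AEMeasurable.tsum
    fun t => (hF t).1.aemeasurable.ennreal_ofReal) h1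
  filter_upwards [h2] with ω hω
  have := ENNReal.summable_toReal hω.ne
  refine this.congr fun t => ?_
  rw [ENNReal.toReal_ofReal (h0 t ω)]

end AveragedGradient

end PSPVBI

namespace PSPVBI

section AveragedGradientMethod

variable {Ω : Type*} {mΩ : MeasurableSpace Ω} {μ : Measure Ω}

theorem integrable_sq_norm_of_bound {F : Type*} [NormedAddCommGroup F] [IsFiniteMeasure μ]
    {g : Ω → F} (hg : AEStronglyMeasurable g μ) {A : ℝ}
    (hA : ∀ᵐ ω ∂μ, ‖g ω‖ ≤ A) : Integrable (fun ω => ‖g ω‖ ^ 2) μ := by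
  refine Integrable.of_bound (hg.norm.pow 2) (A ^ 2) ?_
  filter_upwards [hA] with ω hω
  rw [Real.norm_of_nonneg (by positivity)]
  gcongr

variable {E : Type*} [NormedAddCommGroup E] [InnerProductSpace ℝ E]

open scoped RealInnerProductSpace

theorem integrable_inner_of_bound [IsFiniteMeasure μ] {g g' : Ω → E} (hg : AEStronglyMeasurable g μ)
    (hg' : AEStronglyMeasurable g' μ) {A A' : ℝ} (hA : ∀ᵐ ω ∂μ, ‖g ω‖ ≤ A)
    (hA' : ∀ᵐ ω ∂μ, ‖g' ω‖ ≤ A') : Integrable (fun ω => ⟪g ω, g' ω⟫) μ := by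
  refine Integrable.of_bound (hg.inner hg') (A * A') ?_
  filter_upwards [hA, hA'] with ω h1 h2
  refine (norm_inner_le_norm _ _).trans ?_
  gcongr
  exact (norm_nonneg _).trans h1

/-- A run of a projected stochastic gradient method with averaged gradients `f`, in a real inner
product space. `G` is the gradient of `L` on the convex set `K`, `ξ` is the noise of the gradient
samples, `x̄` is the projected step; the projection enters only through the two variational
inequalities `descent` and `optimality`. -/
structure AveragedGradientRun (K : Set E) (L : E → ℝ) (G : E → E) (c C : ℝ) (ρ γ : ℕ → ℝ)
    (μ : Measure Ω) (x f xbar ξ : ℕ → Ω → E) : Prop where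
  pos : 0 < c
  nonneg : 0 ≤ C
  upper : ∀ x ∈ K, ∀ y ∈ K, L y ≤ L x + ⟪G x, y - x⟫ + C * ‖y - x‖ ^ 2
  lip : ∀ x ∈ K, ∀ y ∈ K, ‖G x - G y‖ ≤ C * ‖x - y‖
  bound_grad : ∀ x ∈ K, ‖G x‖ ≤ C
  bound_obj : ∀ x ∈ K, |L x| ≤ C
  diam : ∀ x ∈ K, ∀ y ∈ K, ‖x - y‖ ≤ C
  mem : ∀ t ω, x t ω ∈ K
  mem_bar : ∀ t ω, xbar t ω ∈ K
  x_succ : ∀ t ω, x (t + 1) ω = x t ω + γ t • (xbar t ω - x t ω)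
  f_zero : ∀ ω, f 0 ω = 0
  f_succ : ∀ t ω, f (t + 1) ω = (1 - ρ t) • f t ω + ρ t • (G (x t ω) + ξ t ω)
  bound_noise : ∀ t, ∀ᵐ ω ∂μ, ‖ξ t ω‖ ≤ C
  descent : ∀ t ω, ⟪f (t + 1) ω, xbar t ω - x t ω⟫ ≤ -c * ‖xbar t ω - x t ω‖ ^ 2
  optimality : ∀ t ω, ∀ y ∈ K, ⟪f (t + 1) ω, xbar t ω - y⟫ ≤ C * ‖xbar t ω - x t ω‖
  meas_x : ∀ t, AEStronglyMeasurable (x t) μ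
  meas_obj : ∀ t, AEStronglyMeasurable (fun ω => L (x t ω)) μ
  meas_grad : ∀ t, AEStronglyMeasurable (fun ω => G (x t ω)) μ
  meas_noise : ∀ t, AEStronglyMeasurable (ξ t) μ
  orthogonal : ∀ t, ∫ ω, ⟪f t ω - G (x t ω), ξ t ω⟫ ∂μ = 0

namespace AveragedGradientRun

variable {K : Set E} {L : E → ℝ} {G : E → E} {c C : ℝ} {ρ γ : ℕ → ℝ} {x f xbar ξ : ℕ → Ω → E}

theorem smul_step (h : AveragedGradientRun K L G c C ρ γ μ x f xbar ξ) (t : ℕ) (ω : Ω) :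
    γ t • (xbar t ω - x t ω) = x (t + 1) ω - x t ω := by
  rw [h.x_succ]; abel

theorem measurable_f (h : AveragedGradientRun K L G c C ρ γ μ x f xbar ξ) (t : ℕ) :
    AEStronglyMeasurable (f t) μ := by
  induction t with
  | zero =>
    have : f 0 = fun _ => 0 := funext h.f_zero
    rw [this]; exact aestronglyMeasurable_const
  | succ t ih =>
    have : f (t + 1) = fun ω => (1 - ρ t) • f t ω + ρ t • (G (x t ω) + ξ t ω) :=
      funext (h.f_succ t)
    rw [this]
    exact (ih.const_smul _).add (((h.meas_grad t).add (h.meas_noise t)).const_smul _)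

/-- The bound may depend on `t`; it only serves integrability and does not enter the estimates. -/
theorem exists_bound_f (h : AveragedGradientRun K L G c C ρ γ μ x f xbar ξ) (t : ℕ) :
    ∃ A : ℝ, ∀ᵐ ω ∂μ, ‖f t ω‖ ≤ A := by
  induction t with
  | zero => exact ⟨0, Eventually.of_forall fun ω => by rw [h.f_zero, norm_zero]⟩
  | succ t ih =>
    obtain ⟨A, hA⟩ := ih
    refine ⟨|1 - ρ t| * A + |ρ t| * (C + C), ?_⟩
    filter_upwards [hA, h.bound_noise t] with ω h1 h2
    rw [h.f_succ]
    refine (norm_add_le _ _).trans ?_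
    rw [norm_smul, norm_smul, Real.norm_eq_abs, Real.norm_eq_abs]
    have h3 := (norm_add_le (G (x t ω)) (ξ t ω)).trans
      (add_le_add (h.bound_grad _ (h.mem t ω)) h2)
    gcongr

theorem dirError_eq (h : AveragedGradientRun K L G c C ρ γ μ x f xbar ξ) (t : ℕ) (ω : Ω) :
    f (t + 1) ω - G (x t ω) = (1 - ρ t) • (f t ω - G (x t ω)) + ρ t • ξ t ω := by
  rw [h.f_succ]; module

theorem integrable_sq_trackError [IsFiniteMeasure μ]
    (h : AveragedGradientRun K L G c C ρ γ μ x f xbar ξ) (t : ℕ) :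
    Integrable (fun ω => ‖f t ω - G (x t ω)‖ ^ 2) μ := by
  obtain ⟨A, hA⟩ := h.exists_bound_f t
  refine integrable_sq_norm_of_bound ((h.measurable_f t).sub (h.meas_grad t)) (A := A + C) ?_
  filter_upwards [hA] with ω hω
  exact (norm_sub_le _ _).trans (add_le_add hω (h.bound_grad _ (h.mem t ω)))

theorem integrable_sq_dirError [IsFiniteMeasure μ]
    (h : AveragedGradientRun K L G c C ρ γ μ x f xbar ξ) (t : ℕ) :
    Integrable (fun ω => ‖f (t + 1) ω - G (x t ω)‖ ^ 2) μ := by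
  obtain ⟨A, hA⟩ := h.exists_bound_f (t + 1)
  refine integrable_sq_norm_of_bound ((h.measurable_f (t + 1)).sub (h.meas_grad t)) (A := A + C) ?_
  filter_upwards [hA] with ω hω
  exact (norm_sub_le _ _).trans (add_le_add hω (h.bound_grad _ (h.mem t ω)))

/-- By `dirError_eq` the new error is a combination of the old one and the noise. Expanding the
square, the cross term integrates to zero by `orthogonal`, so the noise contributes only at order `ρ
^ 2`. -/
theorem integral_sq_dirError_le [IsProbabilityMeasure μ]
    (h : AveragedGradientRun K L G c C ρ γ μ x f xbar ξ) (t : ℕ) :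
    ∫ ω, ‖f (t + 1) ω - G (x t ω)‖ ^ 2 ∂μ
      ≤ (1 - ρ t) ^ 2 * ∫ ω, ‖f t ω - G (x t ω)‖ ^ 2 ∂μ + ρ t ^ 2 * C ^ 2 := by
  have hexp : ∀ ω, ‖f (t + 1) ω - G (x t ω)‖ ^ 2 = (1 - ρ t) ^ 2 * ‖f t ω - G (x t ω)‖ ^ 2
      + (2 * ((1 - ρ t) * ρ t) * ⟪f t ω - G (x t ω), ξ t ω⟫ + ρ t ^ 2 * ‖ξ t ω‖ ^ 2) := by
    intro ω
    rw [h.dirError_eq, norm_add_sq_real, norm_smul, norm_smul, mul_pow, mul_pow,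
      real_inner_smul_left, real_inner_smul_right, Real.norm_eq_abs, Real.norm_eq_abs, sq_abs,
      sq_abs]
    ring
  obtain ⟨A, hA⟩ := h.exists_bound_f t
  have hd : ∀ᵐ ω ∂μ, ‖f t ω - G (x t ω)‖ ≤ A + C := by
    filter_upwards [hA] with ω hω
    exact (norm_sub_le _ _).trans (add_le_add hω (h.bound_grad _ (h.mem t ω)))
  have i1 := h.integrable_sq_trackError t
  have i2 : Integrable (fun ω => ⟪f t ω - G (x t ω), ξ t ω⟫) μ := integrable_inner_of_bound 
    ((h.measurable_f t).sub (h.meas_grad t)) (h.meas_noise t) hd (h.bound_noise t)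
  have i3 := integrable_sq_norm_of_bound (h.meas_noise t) (h.bound_noise t)
  have hξ : ∫ ω, ‖ξ t ω‖ ^ 2 ∂μ ≤ C ^ 2 := by
    have : ∫ ω, ‖ξ t ω‖ ^ 2 ∂μ ≤ ∫ _, C ^ 2 ∂μ := by
      refine integral_mono_ae i3 (integrable_const _) ?_
      filter_upwards [h.bound_noise t] with ω hω
      have := norm_nonneg (ξ t ω)
      gcongr
    simpa using this
  have i23 : Integrable (fun ω => 2 * ((1 - ρ t) * ρ t) * ⟪f t ω - G (x t ω), ξ t ω⟫
      + ρ t ^ 2 * ‖ξ t ω‖ ^ 2) μ := (i2.const_mul _).add (i3.const_mul _)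
  simp_rw [hexp]
  rw [integral_add (i1.const_mul _) i23, integral_add (i2.const_mul _) (i3.const_mul _),
    integral_const_mul, integral_const_mul, integral_const_mul, h.orthogonal t, mul_zero, zero_add]
  gcongr

/-- The direction `f (t + 1)` decreases the linear model by `c` times the squared step. A quarter of
this pays, through Young's inequality, for replacing the gradient by `f (t + 1)`, and a quarter pays
for the curvature once `C * γ t ≤ c / 4`. -/
theorem objective_step_le (h : AveragedGradientRun K L G c C ρ γ μ x f xbar ξ) {t : ℕ} (ω : Ω)
    (hγ : 0 ≤ γ t) (hγC : C * γ t ≤ c / 4) :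
    L (x (t + 1) ω) ≤ L (x t ω) - γ t * (c / 2 * ‖xbar t ω - x t ω‖ ^ 2)
      + γ t * (c⁻¹ * ‖f (t + 1) ω - G (x t ω)‖ ^ 2) := by
  have hc := h.pos
  have h1 := h.upper _ (h.mem t ω) _ (h.mem (t + 1) ω)
  rw [← h.smul_step, real_inner_smul_right, norm_smul, Real.norm_of_nonneg hγ] at h1
  have h2 : ⟪G (x t ω), xbar t ω - x t ω⟫ = ⟪f (t + 1) ω, xbar t ω - x t ω⟫
      - ⟪f (t + 1) ω - G (x t ω), xbar t ω - x t ω⟫ := by rw [inner_sub_left]; ring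
  have h3 := h.descent t ω
  have h4 := abs_real_inner_le_norm (f (t + 1) ω - G (x t ω)) (xbar t ω - x t ω)
  set u := ‖f (t + 1) ω - G (x t ω)‖
  set v := ‖xbar t ω - x t ω‖
  have h5 : u * v ≤ c / 4 * v ^ 2 + c⁻¹ * u ^ 2 := by
    have : c / 4 * v ^ 2 + c⁻¹ * u ^ 2 - u * v = c⁻¹ * (c / 2 * v - u) ^ 2 := by
      field_simp; ring
    have : 0 ≤ c⁻¹ * (c / 2 * v - u) ^ 2 := by positivity
    linarith
  have h6 := (abs_le.1 h4).1
  have h7 : ⟪G (x t ω), xbar t ω - x t ω⟫ ≤ -(3 * c / 4) * v ^ 2 + c⁻¹ * u ^ 2 := by linarith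
  have h8 := mul_le_mul_of_nonneg_left h7 hγ
  have h9 : C * γ t * (γ t * v ^ 2) ≤ c / 4 * (γ t * v ^ 2) :=
    mul_le_mul_of_nonneg_right hγC (by positivity)
  nlinarith

/-- Young's inequality with parameter `ρ t`: the factor `1 + ρ t` is small enough to be beaten by
the contraction `(1 - ρ t) ^ 2` of the averaging. -/
theorem trackError_step_le (h : AveragedGradientRun K L G c C ρ γ μ x f xbar ξ) {t : ℕ} (ω : Ω)
    (hρ : 0 < ρ t) :
    ‖f (t + 1) ω - G (x (t + 1) ω)‖ ^ 2 ≤ (1 + ρ t) * ‖f (t + 1) ω - G (x t ω)‖ ^ 2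
      + (1 + (ρ t)⁻¹) * (C ^ 2 * ‖x (t + 1) ω - x t ω‖ ^ 2) := by
  have h1 : ‖f (t + 1) ω - G (x (t + 1) ω)‖
      ≤ ‖f (t + 1) ω - G (x t ω)‖ + C * ‖x (t + 1) ω - x t ω‖ := by
    have := norm_add_le (f (t + 1) ω - G (x t ω)) (G (x t ω) - G (x (t + 1) ω))
    rw [sub_add_sub_cancel] at this
    refine this.trans (add_le_add le_rfl ?_)
    rw [norm_sub_rev (x (t + 1) ω)]
    exact h.lip _ (h.mem t ω) _ (h.mem (t + 1) ω)
  set u := ‖f (t + 1) ω - G (x t ω)‖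
  set v := C * ‖x (t + 1) ω - x t ω‖ with hv
  have h2 : ‖f (t + 1) ω - G (x (t + 1) ω)‖ ^ 2 ≤ (u + v) ^ 2 := by gcongr
  have h3 : (1 + ρ t) * u ^ 2 + (1 + (ρ t)⁻¹) * v ^ 2 - (u + v) ^ 2
      = (ρ t)⁻¹ * (ρ t * u - v) ^ 2 := by field_simp; ring
  have h4 : 0 ≤ (ρ t)⁻¹ * (ρ t * u - v) ^ 2 := by positivity
  have h5 : C ^ 2 * ‖x (t + 1) ω - x t ω‖ ^ 2 = v ^ 2 := by rw [hv, mul_pow]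
  rw [h5]
  linarith

/-- Almost surely, the squared steps and the squared errors of the search directions are summable
with weights `γ`. -/
theorem ae_summable [IsProbabilityMeasure μ]
    (h : AveragedGradientRun K L G c C ρ γ μ x f xbar ξ) (hst : StepRules ρ γ) :
    ∀ᵐ ω ∂μ, (Summable fun t => γ t * ‖xbar t ω - x t ω‖ ^ 2) ∧
      Summable fun t => γ t * ‖f (t + 1) ω - G (x t ω)‖ ^ 2 := by
  -- `step` is measurable and agrees with `xbar - x` wherever `γ` does not vanish
  set step : ℕ → Ω → E := fun t ω => (γ t)⁻¹ • (x (t + 1) ω - x t ω) with hstep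
  have step_eq : ∀ t ω, γ t * ‖xbar t ω - x t ω‖ ^ 2 = γ t * ‖step t ω‖ ^ 2 := by
    intro t ω
    rcases eq_or_ne (γ t) 0 with h0 | h0
    · simp [h0]
    · rw [hstep]
      simp only
      rw [← h.smul_step, smul_smul, inv_mul_cancel₀ h0, one_smul]
  have smul_step' : ∀ t ω, ‖x (t + 1) ω - x t ω‖ ^ 2 = γ t ^ 2 * ‖step t ω‖ ^ 2 := by
    intro t ω
    rw [← h.smul_step, norm_smul, mul_pow, Real.norm_eq_abs, sq_abs]
    linear_combination γ t * step_eq t ω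
  have istep : ∀ t, Integrable (fun ω => ‖step t ω‖ ^ 2) μ := by
    intro t
    refine integrable_sq_norm_of_bound (((h.meas_x (t + 1)).sub (h.meas_x t)).const_smul _)
      (A := ‖(γ t)⁻¹‖ * C) (Eventually.of_forall fun ω => ?_)
    rw [hstep]
    simp only
    rw [norm_smul]
    exact mul_le_mul_of_nonneg_left (h.diam _ (h.mem _ ω) _ (h.mem _ ω)) (norm_nonneg _)
  have iobj : ∀ t, Integrable (fun ω => L (x t ω)) μ := fun t =>
    Integrable.of_bound (h.meas_obj t) C (Eventually.of_forall fun ω => h.bound_obj _ (h.mem t ω))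
  have idir := h.integrable_sq_dirError
  have hγ0 : ∀ t, 0 ≤ γ t := fun t => (hst.gamma_mem t).1
  have hsmall : ∀ᶠ t in atTop, C * γ t ≤ c / 4 := by
    have := (hst.gamma_tendsto.const_mul C).eventually_lt_const (u := c / 4)
      (by rw [mul_zero]; linarith [h.pos])
    exact this.mono fun t ht => ht.le
  obtain ⟨s1, s2⟩ := summable_of_two_timescale hst
    (a := fun t => ∫ ω, L (x t ω) ∂μ) (b := fun t => ∫ ω, ‖f t ω - G (x t ω)‖ ^ 2 ∂μ)
    (s := fun t => ∫ ω, ‖step t ω‖ ^ 2 ∂μ) (e := fun t => ∫ ω, ‖f (t + 1) ω - G (x t ω)‖ ^ 2 ∂μ)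
    (m := -C) (C := C) h.pos
    (fun t => by
      have : ∫ _, -C ∂μ ≤ ∫ ω, L (x t ω) ∂μ :=
        integral_mono (integrable_const _) (iobj t)
          fun ω => (abs_le.1 (h.bound_obj _ (h.mem t ω))).1
      simpa using this)
    (fun t => integral_nonneg fun ω => by positivity)
    (fun t => integral_nonneg fun ω => by positivity)
    (fun t => integral_nonneg fun ω => by positivity)
    (by
      filter_upwards [hsmall] with t ht
      have hi : Integrable (fun ω => L (x t ω) - γ t * (c / 2 * ‖step t ω‖ ^ 2)) μ :=
        (iobj t).sub (((istep t).const_mul _).const_mul _)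
      have := integral_mono (iobj (t + 1)) (hi.add (((idir t).const_mul c⁻¹).const_mul (γ t)))
        (fun ω => by
          have h1 := h.objective_step_le ω (hγ0 t) ht
          have h2 := step_eq t ω
          have h3 : γ t * (c / 2 * ‖xbar t ω - x t ω‖ ^ 2) = γ t * (c / 2 * ‖step t ω‖ ^ 2) := by
            linear_combination c / 2 * h2
          rw [h3] at h1
          exact h1)
      refine this.trans_eq ?_
      simp only [Pi.add_apply]
      rw [integral_add hi (((idir t).const_mul c⁻¹).const_mul (γ t)),
        integral_sub (iobj t) (((istep t).const_mul _).const_mul _)]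
      simp only [integral_const_mul])
    h.integral_sq_dirError_le
    (fun t => by
      have := integral_mono (h.integrable_sq_trackError (t + 1))
        (((idir t).const_mul (1 + ρ t)).add
          ((istep t).const_mul ((1 + (ρ t)⁻¹) * (C ^ 2 * γ t ^ 2))))
        (fun ω => by
          have h1 := h.trackError_step_le ω (hst.rho_pos t)
          rw [smul_step' t ω] at h1
          refine h1.trans_eq ?_
          simp only [Pi.add_apply]
          ring)
      refine this.trans_eq ?_
      simp only [Pi.add_apply]
      rw [integral_add ((idir t).const_mul _) ((istep t).const_mul _), integral_const_mul,
        integral_const_mul]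
      ring)
  have a1 : ∀ᵐ ω ∂μ, Summable fun t => γ t * ‖step t ω‖ ^ 2 :=
    ae_summable_of_summable_integral (fun t ω => mul_nonneg (hγ0 t) (by positivity))
      (fun t => (istep t).const_mul _) (by simpa only [integral_const_mul] using s1)
  have a2 : ∀ᵐ ω ∂μ, Summable fun t => γ t * ‖f (t + 1) ω - G (x t ω)‖ ^ 2 :=
    ae_summable_of_summable_integral (fun t ω => mul_nonneg (hγ0 t) (by positivity))
      (fun t => (idir t).const_mul _) (by simpa only [integral_const_mul] using s2)
  filter_upwards [a1, a2] with ω h1 h2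
  exact ⟨h1.congr fun t => (step_eq t ω).symm, h2⟩

/-- The gap splits into the optimality defect of the projected point, the direction error paired
with a vector of bounded length, and the change from `x` to `xbar`. -/
theorem gap_le (h : AveragedGradientRun K L G c C ρ γ μ x f xbar ξ) (t : ℕ) (ω : Ω) {y : E}
    (hy : y ∈ K) : ⟪G (x t ω), x t ω - y⟫
      ≤ 2 * C * (‖xbar t ω - x t ω‖ + ‖f (t + 1) ω - G (x t ω)‖) := by
  have e1 : ⟪G (x t ω), x t ω - y⟫ = ⟪f (t + 1) ω, xbar t ω - y⟫
      - ⟪f (t + 1) ω - G (x t ω), xbar t ω - y⟫ - ⟪G (x t ω), xbar t ω - x t ω⟫ := by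
    simp only [inner_sub_left, inner_sub_right]; ring
  have h1 := h.optimality t ω y hy
  have h2 := (abs_le.1 (abs_real_inner_le_norm (f (t + 1) ω - G (x t ω)) (xbar t ω - y))).1
  have h3 := (abs_le.1 (abs_real_inner_le_norm (G (x t ω)) (xbar t ω - x t ω))).1
  have h4 : ‖f (t + 1) ω - G (x t ω)‖ * ‖xbar t ω - y‖ ≤ ‖f (t + 1) ω - G (x t ω)‖ * C :=
    mul_le_mul_of_nonneg_left (h.diam _ (h.mem_bar t ω) _ hy) (norm_nonneg _)
  have h5 : ‖G (x t ω)‖ * ‖xbar t ω - x t ω‖ ≤ C * ‖xbar t ω - x t ω‖ :=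
    mul_le_mul_of_nonneg_right (h.bound_grad _ (h.mem t ω)) (norm_nonneg _)
  have h6 := mul_nonneg h.nonneg (norm_nonneg (f (t + 1) ω - G (x t ω)))
  linarith

theorem abs_gap_sub_le (h : AveragedGradientRun K L G c C ρ γ μ x f xbar ξ) {u v y : E}
    (hu : u ∈ K) (hv : v ∈ K) (hy : y ∈ K) :
    |⟪G u, u - y⟫ - ⟪G v, v - y⟫| ≤ (C * C + C) * ‖u - v‖ := by
  have e1 : ⟪G u, u - y⟫ - ⟪G v, v - y⟫ = ⟪G u - G v, u - y⟫ + ⟪G v, u - v⟫ := by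
    simp only [inner_sub_left, inner_sub_right]; ring
  rw [e1]
  refine (abs_add_le _ _).trans ?_
  have h1 : |⟪G u - G v, u - y⟫| ≤ C * ‖u - v‖ * C :=
    (abs_real_inner_le_norm _ _).trans (mul_le_mul (h.lip _ hu _ hv) (h.diam _ hu _ hy)
      (norm_nonneg _) (mul_nonneg h.nonneg (norm_nonneg _)))
  have h2 : |⟪G v, u - v⟫| ≤ C * ‖u - v‖ :=
    (abs_real_inner_le_norm _ _).trans
      (mul_le_mul_of_nonneg_right (h.bound_grad _ hv) (norm_nonneg _))
  linarith

/-- Almost surely, every limit point of the iterates satisfies the first-order condition. -/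
theorem ae_forall_limit_point [IsProbabilityMeasure μ]
    (h : AveragedGradientRun K L G c C ρ γ μ x f xbar ξ) (hst : StepRules ρ γ) :
    ∀ᵐ ω ∂μ, ∀ z ∈ K, MapClusterPt z atTop (fun t => x t ω) →
      ∀ y ∈ K, 0 ≤ ⟪G z, y - z⟫ := by
  filter_upwards [h.ae_summable hst] with ω hω z hz hcl y hy
  obtain ⟨hs1, hs2⟩ := hω
  have hC := h.nonneg
  -- The event of full measure was fixed before `y` and `z`, so no union over uncountably many
  -- points arises. The positive part makes the sequence nonnegative without enlarging its
  -- increments.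
  have hlim : Tendsto (fun t => max 0 ⟪G (x t ω), x t ω - y⟫) atTop (𝓝 0) := by
    refine tendsto_zero_of_summable_mul_sq (C := (C * C + C) * C) hst.gamma_mem hst.gamma_sum
      hst.gamma_sq_summable (fun t => le_max_left _ _) (fun t => ?_) ?_
    · refine (abs_max_sub_max_le_max _ _ _ _).trans ?_
      rw [sub_self, abs_zero, max_eq_right (abs_nonneg _)]
      refine (h.abs_gap_sub_le (h.mem _ ω) (h.mem _ ω) hy).trans ?_
      rw [← h.smul_step, norm_smul, Real.norm_of_nonneg (hst.gamma_mem t).1, mul_assoc,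
        mul_comm C (γ t)]
      have := h.diam _ (h.mem_bar t ω) _ (h.mem t ω)
      have := (hst.gamma_mem t).1
      gcongr
    · refine Summable.of_nonneg_of_le (fun t => mul_nonneg (hst.gamma_mem t).1 (sq_nonneg _))
        (fun t => ?_) ((hs1.add hs2).mul_left (8 * C ^ 2))
      have h1 := h.gap_le t ω hy
      set a := ‖xbar t ω - x t ω‖
      set b := ‖f (t + 1) ω - G (x t ω)‖
      have ha : 0 ≤ a := norm_nonneg _
      have hb : 0 ≤ b := norm_nonneg _
      have h2 : max 0 ⟪G (x t ω), x t ω - y⟫ ^ 2 ≤ (2 * C * (a + b)) ^ 2 := by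
        have : max 0 ⟪G (x t ω), x t ω - y⟫ ≤ 2 * C * (a + b) := max_le (by positivity) h1
        have : 0 ≤ max 0 ⟪G (x t ω), x t ω - y⟫ := le_max_left _ _
        gcongr
      have h3 : (2 * C * (a + b)) ^ 2 ≤ 8 * C ^ 2 * (a ^ 2 + b ^ 2) := by
        nlinarith [mul_nonneg (sq_nonneg C) (sq_nonneg (a - b))]
      calc γ t * max 0 ⟪G (x t ω), x t ω - y⟫ ^ 2 ≤ γ t * (8 * C ^ 2 * (a ^ 2 + b ^ 2)) :=
            mul_le_mul_of_nonneg_left (h2.trans h3) (hst.gamma_mem t).1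
        _ = _ := by ring
  have hle : ⟪G z, z - y⟫ ≤ 0 := by
    refine le_of_forall_pos_le_add fun δ hδ => ?_
    -- The gap has Lipschitz constant `C * C + C`; the added 1 makes the radius below well defined
    -- when `C = 0`.
    have hA : 0 < C * C + C + 1 := by positivity
    have hball : ∃ᶠ t in atTop, x t ω ∈ Metric.ball z (δ / 2 / (C * C + C + 1)) :=
      mapClusterPt_iff_frequently.1 hcl _ (Metric.ball_mem_nhds _ (by positivity))
    have hev : ∀ᶠ t in atTop, max 0 ⟪G (x t ω), x t ω - y⟫ < δ / 2 :=
      hlim.eventually_lt_const (by positivity)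
    obtain ⟨t, ht1, ht2⟩ := (hball.and_eventually hev).exists
    rw [Metric.mem_ball, dist_eq_norm, lt_div_iff₀ hA] at ht1
    have h1 := (abs_le.1 (h.abs_gap_sub_le (h.mem t ω) hz hy)).1
    have h2 := le_max_right 0 ⟪G (x t ω), x t ω - y⟫
    have := norm_nonneg (x t ω - z)
    linarith
  have : ⟪G z, y - z⟫ = -⟪G z, z - y⟫ := by rw [← inner_neg_right, neg_sub]
  linarith

end AveragedGradientRun

end AveragedGradientMethod

end PSPVBI

namespace PSPVBI

/-! ### Conditional expectations under a finitely supported conditional law. -/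

section ConditionalLaw

/-- If, conditionally on `m`, the variable `θ` equals `P ν` with probability `W ν`, then the
conditional expectation of `h (X, θ)` given `m` is `∑ ν, W ν * h (X, P ν)` for `m`-measurable
`X`. -/
theorem condExp_comp_of_finite_law {Ω S Θ ι : Type*} [Fintype ι] [MeasurableSpace S]
    [MeasurableSpace Θ] {m mΩ : MeasurableSpace Ω} (hm : m ≤ mΩ) {μ : Measure Ω}
    [IsFiniteMeasure μ] {X : Ω → S} (hX : Measurable[m] X) {θ : Ω → Θ} (hθ : Measurable θ)
    {W : ι → Ω → ℝ} (hW : ∀ ν, Measurable[m] (W ν)) (hW0 : ∀ ν ω, 0 ≤ W ν ω)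
    (hW1 : ∀ ν ω, W ν ω ≤ 1) {P : ι → Ω → Θ} (hP : ∀ ν, Measurable[m] (P ν))
    (hlaw : ∀ A : Set Θ, MeasurableSet A → μ[(θ ⁻¹' A).indicator (fun _ => (1 : ℝ)) | m] =ᵐ[μ]
      fun ω => ∑ ν, W ν ω * A.indicator (fun _ => 1) (P ν ω))
    {h : S × Θ → ℝ} (hh : Measurable h) {C : ℝ} (hb : ∀ z, |h z| ≤ C) :
    μ[fun ω => h (X ω, θ ω) | m] =ᵐ[μ] fun ω => ∑ ν, W ν ω * h (X ω, P ν ω) := by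
  have hX' : Measurable X := hX.mono hm le_rfl
  have hW' : ∀ ν, Measurable (W ν) := fun ν => (hW ν).mono hm le_rfl
  have hP' : ∀ ν, Measurable (P ν) := fun ν => (hP ν).mono hm le_rfl
  have hbound : ∀ {g : Ω → ℝ}, Measurable g → ∀ D : ℝ, (∀ ω, |g ω| ≤ D) → Integrable g μ :=
    fun hg D hD => Integrable.of_bound hg.aestronglyMeasurable D (Eventually.of_forall hD)
  have iWh : ∀ ν, Integrable (fun ω => W ν ω * h (X ω, P ν ω)) μ := fun ν =>
    hbound ((hW' ν).mul (hh.comp (hX'.prodMk (hP' ν)))) (1 * C) fun ω => by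
      rw [abs_mul, abs_of_nonneg (hW0 ν ω)]
      exact mul_le_mul (hW1 ν ω) (hb _) (abs_nonneg _) zero_le_one
  symm
  refine ae_eq_condExp_of_forall_setIntegral_eq hm
    (hbound (hh.comp (hX'.prodMk hθ)) C fun ω => hb _)
    (fun F _ _ => (integrable_finsetSum _ fun ν _ => iWh ν).integrableOn) ?_ ?_
  swap
  · refine (Measurable.stronglyMeasurable ?_).aestronglyMeasurable
    exact Finset.measurable_sum _ fun ν _ => (hW ν).mul (hh.comp (hX.prodMk (hP ν)))
  intro F hF _
  -- On each `F` in `m`, the joint law of `(X, θ)` is a mixture of the laws of `(X, P ν)`. It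
  -- suffices to test rectangles `D ×ˢ A`: as `X ⁻¹' D ∩ F` is again in `m`, the assumed conditional
  -- probabilities of `A` decide.
  have hlaw_eq : (μ.restrict F).map (fun ω => (X ω, θ ω)) = ∑ ν,
      ((μ.restrict F).withDensity fun ω => ENNReal.ofReal (W ν ω)).map
        fun ω => (X ω, P ν ω) := by
    refine Measure.ext_prod fun {D A} hD hA => ?_
    have hDF : MeasurableSet[m] (X ⁻¹' D ∩ F) := (hX hD).inter hF
    have hDF' : MeasurableSet (X ⁻¹' D ∩ F) := hm _ hDF
    have key : ∫ ω in X ⁻¹' D ∩ F, (θ ⁻¹' A).indicator (fun _ => (1 : ℝ)) ω ∂μ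
        = ∫ ω in X ⁻¹' D ∩ F, ∑ ν, W ν ω * A.indicator (fun _ => 1) (P ν ω) ∂μ := by
      rw [← setIntegral_condExp hm ((integrable_const 1).indicator (hθ hA)) hDF]
      exact setIntegral_congr_ae hDF' ((hlaw A hA).mono fun ω hω _ => hω)
    have ind0 : ∀ z, 0 ≤ A.indicator (fun _ => (1 : ℝ)) z := fun z =>
      Set.indicator_nonneg (fun _ _ => zero_le_one) z
    have iWA : ∀ ν, Integrable (fun ω => W ν ω * A.indicator (fun _ => (1 : ℝ)) (P ν ω)) μ :=
      fun ν => hbound ((hW' ν).mul ((measurable_const.indicator hA).comp (hP' ν))) (1 * 1)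
        fun ω => by
          rw [abs_mul, abs_of_nonneg (hW0 ν ω), abs_of_nonneg (ind0 _)]
          exact mul_le_mul (hW1 ν ω) (Set.indicator_le_self' (fun _ _ => zero_le_one) _)
            (ind0 _) zero_le_one
    have key' : ∫⁻ ω in X ⁻¹' D ∩ F, ENNReal.ofReal ((θ ⁻¹' A).indicator (fun _ => (1 : ℝ)) ω) ∂μ
        = ∫⁻ ω in X ⁻¹' D ∩ F,
          ENNReal.ofReal (∑ ν, W ν ω * A.indicator (fun _ => 1) (P ν ω)) ∂μ := by
      rw [← ofReal_integral_eq_lintegral_ofReal, ← ofReal_integral_eq_lintegral_ofReal, key]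
      · exact (integrable_finsetSum _ fun ν _ => iWA ν).integrableOn
      · exact Eventually.of_forall fun ω =>
          Finset.sum_nonneg fun ν _ => mul_nonneg (hW0 ν ω) (ind0 _)
      · exact ((integrable_const 1).indicator (hθ hA)).integrableOn
      · exact Eventually.of_forall fun ω => Set.indicator_nonneg (fun _ _ => zero_le_one) _
    rw [Measure.map_apply (hX'.prodMk hθ) (hD.prod hA), Measure.finsetSum_apply]
    have lhs : (μ.restrict F) ((fun ω => (X ω, θ ω)) ⁻¹' D ×ˢ A)
        = ∫⁻ ω in X ⁻¹' D ∩ F, ENNReal.ofReal ((θ ⁻¹' A).indicator (fun _ => (1 : ℝ)) ω) ∂μ := by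
      have : ∀ ω, ENNReal.ofReal ((θ ⁻¹' A).indicator (fun _ => (1 : ℝ)) ω)
          = (θ ⁻¹' A).indicator 1 ω := by
        intro ω
        by_cases hω : ω ∈ θ ⁻¹' A <;> simp [hω]
      simp_rw [this]
      rw [lintegral_indicator_one (hθ hA), Measure.restrict_apply (hθ hA),
        Measure.restrict_apply ((hX'.prodMk hθ) (hD.prod hA))]
      congr 1
      ext ω
      simp only [Set.mem_inter_iff, Set.mem_preimage, Set.mem_prod]
      tauto
    rw [lhs, key']
    have hsum : ∀ ω, ENNReal.ofReal (∑ ν, W ν ω * A.indicator (fun _ => (1 : ℝ)) (P ν ω))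
        = ∑ ν, (P ν ⁻¹' A).indicator (fun ω => ENNReal.ofReal (W ν ω)) ω := by
      intro ω
      rw [ENNReal.ofReal_sum_of_nonneg fun ν _ => mul_nonneg (hW0 ν ω) (ind0 _)]
      refine Finset.sum_congr rfl fun ν _ => ?_
      by_cases hω : P ν ω ∈ A
      · rw [Set.indicator_of_mem hω, Set.indicator_of_mem (show ω ∈ P ν ⁻¹' A from hω), mul_one]
      · rw [Set.indicator_of_notMem hω, Set.indicator_of_notMem (show ω ∉ P ν ⁻¹' A from hω),
          mul_zero, ENNReal.ofReal_zero]
    simp_rw [hsum]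
    rw [lintegral_finsetSum _ fun ν _ => (hW' ν).ennreal_ofReal.indicator (hP' ν hA)]
    refine Finset.sum_congr rfl fun ν _ => ?_
    have hmeas := (hX'.prodMk (hP' ν)) (hD.prod hA)
    rw [Measure.map_apply (hX'.prodMk (hP' ν)) (hD.prod hA), withDensity_apply _ hmeas,
      lintegral_indicator (hP' ν hA), Measure.restrict_restrict (hP' ν hA),
      Measure.restrict_restrict hmeas]
    congr 2
    ext ω
    simp only [Set.mem_inter_iff, Set.mem_preimage, Set.mem_prod]
    tauto
  have hfin : ∀ ν, IsFiniteMeasure ((μ.restrict F).withDensity fun ω => ENNReal.ofReal (W ν ω)) := by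
    intro ν
    refine isFiniteMeasure_withDensity_ofReal ?_
    refine (hbound (hW' ν) 1 fun ω => ?_).integrableOn.2
    rw [abs_of_nonneg (hW0 ν ω)]; exact hW1 ν ω
  have e1 : ∫ ω in F, h (X ω, θ ω) ∂μ = ∫ z, h z ∂(μ.restrict F).map (fun ω => (X ω, θ ω)) :=
    (integral_map (hX'.prodMk hθ).aemeasurable hh.aestronglyMeasurable).symm
  rw [e1, hlaw_eq, integral_finsetSum _ fun ν _ => (iWh ν).integrableOn,
    integral_finsetSum_measure]
  · refine Finset.sum_congr rfl fun ν _ => ?_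
    rw [integral_map (hX'.prodMk (hP' ν)).aemeasurable hh.aestronglyMeasurable,
      integral_withDensity_eq_integral_toReal_smul (hW' ν).ennreal_ofReal
        (Eventually.of_forall fun ω => ENNReal.ofReal_lt_top)]
    refine integral_congr_ae (Eventually.of_forall fun ω => ?_)
    simp only [smul_eq_mul]
    rw [ENNReal.toReal_ofReal (hW0 ν ω)]
  · intro ν _
    have := hfin ν
    exact Integrable.of_bound hh.aestronglyMeasurable C (Eventually.of_forall hb)

theorem isProbabilityMeasure_weighted_dirac {n : ℕ} {v : Fin n → ℝ} (hv0 : ∀ i, 0 ≤ v i)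
    (hv1 : ∑ i, v i = 1) (x : Fin n → ℝ) :
    IsProbabilityMeasure (∑ i, ENNReal.ofReal (v i) • Measure.dirac (x i)) := by
  constructor
  simp [← ENNReal.ofReal_sum_of_nonneg fun i _ => hv0 i, hv1]

/-- The particle distribution is the finite mixture of the joint particles. -/
theorem particleLaw_eq_sum {J Np : ℕ} {p w : Particles J Np} (hw0 : ∀ j n, 0 ≤ w j n)
    (hw1 : ∀ j, ∑ n, w j n = 1) :
    particleLaw p w = ∑ ν : Fin J → Fin Np, ENNReal.ofReal (∏ j, w j (ν j)) •
      Measure.dirac (fun j => p j (ν j)) := by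
  have := fun j => isProbabilityMeasure_weighted_dirac (hw0 j) (hw1 j) (p j)
  refine Measure.pi_eq fun s hs => ?_
  simp only [Measure.finsetSum_apply, Measure.smul_apply, smul_eq_mul]
  -- On a rectangle the product measure is a product of sums; distributing it produces one term for
  -- each selection `ν`.
  rw [Finset.prod_univ_sum, Fintype.piFinset_univ]
  refine Finset.sum_congr rfl fun ν _ => ?_
  rw [Finset.prod_mul_distrib, ENNReal.ofReal_prod_of_nonneg fun j _ => hw0 j _,
    Measure.dirac_apply' _ (MeasurableSet.univ_pi hs)]
  congr 1
  by_cases h : (fun j => p j (ν j)) ∈ Set.univ.pi s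
  · rw [Set.indicator_of_mem h]
    refine (Finset.prod_eq_one fun j _ => ?_).symm
    rw [Measure.dirac_apply' _ (hs j), Set.indicator_of_mem (h j trivial)]; rfl
  · rw [Set.indicator_of_notMem h]
    simp only [Set.mem_univ_pi, not_forall] at h
    obtain ⟨j, hj⟩ := h
    refine (Finset.prod_eq_zero (Finset.mem_univ j) ?_).symm
    rw [Measure.dirac_apply' _ (hs j), Set.indicator_of_notMem hj]

theorem isProbabilityMeasure_particleLaw {J Np : ℕ} {p w : Particles J Np}
    (hw0 : ∀ j n, 0 ≤ w j n) (hw1 : ∀ j, ∑ n, w j n = 1) :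
    IsProbabilityMeasure (particleLaw p w) := by
  have := fun j => isProbabilityMeasure_weighted_dirac (hw0 j) (hw1 j) (p j)
  exact inferInstanceAs (IsProbabilityMeasure (Measure.pi _))

theorem particleLaw_real_apply {J Np : ℕ} {p w : Particles J Np} (hw0 : ∀ j n, 0 ≤ w j n)
    (hw1 : ∀ j, ∑ n, w j n = 1) {A : Set (Fin J → ℝ)} (hA : MeasurableSet A) :
    (particleLaw p w).real A = ∑ ν : Fin J → Fin Np, (∏ j, w j (ν j)) *
      A.indicator (fun _ => (1 : ℝ)) (fun j => p j (ν j)) := by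
  rw [Measure.real, particleLaw_eq_sum hw0 hw1, Measure.finsetSum_apply]
  simp only [Measure.smul_apply, smul_eq_mul, Measure.dirac_apply' _ hA]
  rw [ENNReal.toReal_sum]
  · refine Finset.sum_congr rfl fun ν _ => ?_
    rw [ENNReal.toReal_mul, ENNReal.toReal_ofReal (Finset.prod_nonneg fun j _ => hw0 j _)]
    congr 1
    by_cases h : (fun j => p j (ν j)) ∈ A <;> simp [h]
  · intro ν _
    refine ENNReal.mul_ne_top ENNReal.ofReal_ne_top ?_
    by_cases h : (fun j => p j (ν j)) ∈ A <;> simp [h]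

end ConditionalLaw

end PSPVBI

namespace PSPVBI

/-! ### Calculus of bounded Lipschitz functions; boundedness is what closes the class under
products. -/

section BddLip

variable {E F E' : Type*} [NormedAddCommGroup E] [NormedAddCommGroup F] [NormedAddCommGroup E']

/-- `f` is bounded and Lipschitz continuous on `s`. -/
def BddLipOn (f : E → F) (s : Set E) : Prop :=
  ∃ C : ℝ, 0 ≤ C ∧ (∀ x ∈ s, ‖f x‖ ≤ C) ∧ ∀ x ∈ s, ∀ y ∈ s, ‖f x - f y‖ ≤ C * ‖x - y‖

namespace BddLipOn

variable {s : Set E}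

theorem of_bounds {f : E → F} {A B : ℝ} (hA : ∀ x ∈ s, ‖f x‖ ≤ A)
    (hB : ∀ x ∈ s, ∀ y ∈ s, ‖f x - f y‖ ≤ B * ‖x - y‖) : BddLipOn f s := by
  refine ⟨max 0 (max A B), le_max_left _ _, fun x hx => (hA x hx).trans ?_, fun x hx y hy =>
    (hB x hx y hy).trans (mul_le_mul_of_nonneg_right ?_ (norm_nonneg _))⟩
  · exact (le_max_left A B).trans (le_max_right _ _)
  · exact (le_max_right A B).trans (le_max_right _ _)

theorem congr {f g : E → F} (hf : BddLipOn f s) (h : ∀ x ∈ s, g x = f x) : BddLipOn g s := by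
  obtain ⟨C, hC, h1, h2⟩ := hf
  refine ⟨C, hC, fun x hx => ?_, fun x hx y hy => ?_⟩
  · rw [h x hx]; exact h1 x hx
  · rw [h x hx, h y hy]; exact h2 x hx y hy

theorem const (a : F) : BddLipOn (fun _ : E => a) s :=
  of_bounds (A := ‖a‖) (B := 0) (fun _ _ => le_rfl) (fun _ _ _ _ => by simp)

theorem add {f g : E → F} (hf : BddLipOn f s) (hg : BddLipOn g s) :
    BddLipOn (fun x => f x + g x) s := by
  obtain ⟨C, hC, h1, h2⟩ := hf
  obtain ⟨D, hD, k1, k2⟩ := hg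
  refine ⟨C + D, by positivity, fun x hx => (norm_add_le _ _).trans
    (add_le_add (h1 x hx) (k1 x hx)), fun x hx y hy => ?_⟩
  rw [add_sub_add_comm, add_mul]
  exact (norm_add_le _ _).trans (add_le_add (h2 x hx y hy) (k2 x hx y hy))

theorem neg {f : E → F} (hf : BddLipOn f s) : BddLipOn (fun x => -f x) s := by
  obtain ⟨C, hC, h1, h2⟩ := hf
  refine ⟨C, hC, fun x hx => (norm_neg _).trans_le (h1 x hx), fun x hx y hy => ?_⟩
  rw [neg_sub_neg, norm_sub_rev]
  exact h2 x hx y hy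

theorem sub {f g : E → F} (hf : BddLipOn f s) (hg : BddLipOn g s) :
    BddLipOn (fun x => f x - g x) s := by
  simpa only [sub_eq_add_neg] using hf.add hg.neg

theorem mul {f g : E → ℝ} (hf : BddLipOn f s) (hg : BddLipOn g s) :
    BddLipOn (fun x => f x * g x) s := by
  obtain ⟨C, hC, h1, h2⟩ := hf
  obtain ⟨D, hD, k1, k2⟩ := hg
  refine of_bounds (A := C * D) (B := C * D + C * D) (fun x hx => ?_) (fun x hx y hy => ?_)
  · rw [norm_mul]
    exact mul_le_mul (h1 x hx) (k1 x hx) (norm_nonneg _) hC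
  · have : f x * g x - f y * g y = (f x - f y) * g x + f y * (g x - g y) := by ring
    rw [this]
    refine (norm_add_le _ _).trans ?_
    rw [norm_mul, norm_mul, add_mul]
    refine add_le_add ?_ ?_
    · calc _ ≤ C * ‖x - y‖ * D := mul_le_mul (h2 x hx y hy) (k1 x hx) (norm_nonneg _)
            (mul_nonneg hC (norm_nonneg _))
        _ = _ := by ring
    · calc _ ≤ C * (D * ‖x - y‖) := mul_le_mul (h1 y hy) (k2 x hx y hy) (norm_nonneg _) hC
        _ = _ := by ring

theorem sum {ι : Type*} {f : ι → E → F} (t : Finset ι) (hf : ∀ i ∈ t, BddLipOn (f i) s) :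
    BddLipOn (fun x => ∑ i ∈ t, f i x) s := by
  classical
  induction t using Finset.induction_on with
  | empty => simpa using const (0 : F)
  | insert i t hi ih =>
    simp only [Finset.sum_insert hi]
    exact (hf i (Finset.mem_insert_self i t)).add
      (ih fun k hk => hf k (Finset.mem_insert_of_mem hk))

theorem prod {ι : Type*} {f : ι → E → ℝ} (t : Finset ι) (hf : ∀ i ∈ t, BddLipOn (f i) s) :
    BddLipOn (fun x => ∏ i ∈ t, f i x) s := by
  classical
  induction t using Finset.induction_on with
  | empty => simpa using const (1 : ℝ)
  | insert i t hi ih =>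
    simp only [Finset.prod_insert hi]
    exact (hf i (Finset.mem_insert_self i t)).mul
      (ih fun k hk => hf k (Finset.mem_insert_of_mem hk))

theorem comp {s' : Set E'} {f : E' → F} (hf : BddLipOn f s') {g : E → E'} {A : ℝ}
    (hg : Set.MapsTo g s s') (hA : ∀ x ∈ s, ∀ y ∈ s, ‖g x - g y‖ ≤ A * ‖x - y‖) :
    BddLipOn (fun x => f (g x)) s := by
  obtain ⟨C, hC, h1, h2⟩ := hf
  refine of_bounds (A := C) (B := C * A) (fun x hx => h1 _ (hg hx)) (fun x hx y hy => ?_)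
  rw [mul_assoc]
  exact (h2 _ (hg hx) _ (hg hy)).trans (mul_le_mul_of_nonneg_left (hA x hx y hy) hC)

theorem clm_apply [NormedSpace ℝ E'] [NormedSpace ℝ F] {f : E → E' →L[ℝ] F}
    (hf : BddLipOn f s) (v : E') : BddLipOn (fun x => f x v) s := by
  obtain ⟨C, hC, h1, h2⟩ := hf
  refine of_bounds (A := C * ‖v‖) (B := C * ‖v‖) (fun x hx => ?_) (fun x hx y hy => ?_)
  · exact ((f x).le_opNorm v).trans (mul_le_mul_of_nonneg_right (h1 x hx) (norm_nonneg _))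
  · calc ‖f x v - f y v‖ ≤ ‖f x - f y‖ * ‖v‖ := (f x - f y).le_opNorm v
      _ ≤ C * ‖x - y‖ * ‖v‖ := mul_le_mul_of_nonneg_right (h2 x hx y hy) (norm_nonneg _)
      _ = _ := by ring

theorem pi {ι : Type*} [Fintype ι] {F : Type*} [NormedAddCommGroup F] {f : E → ι → F}
    (hf : ∀ i, BddLipOn (fun x => f x i) s) : BddLipOn f s := by
  choose C hC h1 h2 using hf
  have hle : ∀ i, C i ≤ ∑ k, C k := fun i =>
    Finset.single_le_sum (fun k _ => hC k) (Finset.mem_univ i)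
  have h0 : 0 ≤ ∑ k, C k := Finset.sum_nonneg fun k _ => hC k
  refine ⟨∑ k, C k, h0, fun x hx => ?_, fun x hx y hy => ?_⟩
  · exact (pi_norm_le_iff_of_nonneg h0).2 fun i => (h1 i x hx).trans (hle i)
  · refine (pi_norm_le_iff_of_nonneg (by positivity)).2 fun i => (h2 i x hx y hy).trans ?_
    exact mul_le_mul_of_nonneg_right (hle i) (norm_nonneg _)

theorem prodMk {f : E → F} {g : E → E'} (hf : BddLipOn f s) (hg : BddLipOn g s) :
    BddLipOn (fun x => (f x, g x)) s := by
  obtain ⟨C, hC, h1, h2⟩ := hf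
  obtain ⟨D, hD, k1, k2⟩ := hg
  refine ⟨max C D, le_max_of_le_left hC, fun x hx => ?_, fun x hx y hy => ?_⟩
  · exact max_le_max (h1 x hx) (k1 x hx)
  · rw [max_mul_of_nonneg _ _ (norm_nonneg _)]
    exact max_le_max (h2 x hx y hy) (k2 x hx y hy)

theorem continuousOn {f : E → F} (hf : BddLipOn f s) : ContinuousOn f s := by
  obtain ⟨C, hC, _, h2⟩ := hf
  have : LipschitzOnWith C.toNNReal f s := by
    rw [lipschitzOnWith_iff_norm_sub_le]
    intro x hx y hy
    rw [Real.coe_toNNReal C hC]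
    exact h2 x hx y hy
  exact this.continuousOn

end BddLipOn

theorem bddLipOn_of_lipschitzOnWith {f : E → F} {s : Set E} {k : ℝ≥0} {D : ℝ}
    (hD : ∀ x ∈ s, ∀ y ∈ s, ‖x - y‖ ≤ D) (hf : LipschitzOnWith k f s) : BddLipOn f s := by
  rw [lipschitzOnWith_iff_norm_sub_le] at hf
  rcases s.eq_empty_or_nonempty with rfl | ⟨a, ha⟩
  · exact ⟨0, le_rfl, by simp, by simp⟩
  refine BddLipOn.of_bounds (A := k * D + ‖f a‖) (B := k) (fun x hx => ?_)
    (fun x hx y hy => hf hx hy)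
  have h1 : ‖f x‖ ≤ ‖f x - f a‖ + ‖f a‖ := by simpa using norm_add_le (f x - f a) (f a)
  have h2 := (hf hx ha).trans (mul_le_mul_of_nonneg_left (hD x hx a ha) k.coe_nonneg)
  linarith

variable [NormedSpace ℝ E] [NormedSpace ℝ F]

/-- On a bounded convex set, a function with Lipschitz gradient is itself bounded and Lipschitz. -/
theorem LipschitzGradientOn.exists_bddLipOn {f : E → F} {s : Set E} {D : ℝ}
    (hf : LipschitzGradientOn f s) (hD : ∀ x ∈ s, ∀ y ∈ s, ‖x - y‖ ≤ D) (hs : Convex ℝ s) :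
    BddLipOn f s ∧ ∃ f' : E → E →L[ℝ] F,
      (∀ x ∈ s, HasFDerivWithinAt f (f' x) s x) ∧ BddLipOn f' s := by
  obtain ⟨f', k, h1, h2⟩ := hf
  have h3 : BddLipOn f' s := bddLipOn_of_lipschitzOnWith hD h2
  refine ⟨?_, f', h1, h3⟩
  obtain ⟨C, hC, k1, _⟩ := h3
  have : LipschitzOnWith C.toNNReal f s :=
    hs.lipschitzOnWith_of_nnnorm_hasFDerivWithin_le h1 fun x hx => by
      rw [← NNReal.coe_le_coe, Real.coe_toNNReal C hC]
      exact k1 x hx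
  exact bddLipOn_of_lipschitzOnWith hD this

/-- A derivative within `s` may be altered away from the directions into `s`. -/
theorem _root_.HasFDerivWithinAt.congr_on_directions {f : E → F} {D D' : E →L[ℝ] F} {s : Set E}
    {x : E} (h : HasFDerivWithinAt f D s x) (hD : ∀ y ∈ s, D (y - x) = D' (y - x)) :
    HasFDerivWithinAt f D' s x := by
  rw [hasFDerivWithinAt_iff_isLittleO] at h ⊢
  refine h.congr' ?_ EventuallyEq.rfl
  filter_upwards [self_mem_nhdsWithin] with y hy
  rw [hD y hy]

end BddLip

/-! ### The search box and the partial derivatives of the log-posterior. -/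

namespace Model

variable {J N : ℕ} (M : Model J N)

theorem convex_interval (j : Fin J) : Convex ℝ (M.interval j) := convex_Icc _ _

theorem box_eq_pi : M.box = Set.univ.pi M.interval := by
  ext θ; simp [box]

theorem convex_box : Convex ℝ M.box := by
  rw [box_eq_pi]
  exact convex_pi fun j _ => M.convex_interval j

theorem isClosed_box : IsClosed M.box := by
  rw [box_eq_pi]
  exact isClosed_set_pi fun j _ => isClosed_Icc

theorem norm_sub_le_width {j : Fin J} {s t : ℝ} (hs : s ∈ M.interval j)
    (ht : t ∈ M.interval j) : ‖s - t‖ ≤ M.width j := by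
  obtain ⟨h1, h2⟩ := hs
  obtain ⟨h3, h4⟩ := ht
  rw [Real.norm_eq_abs, abs_le]
  constructor <;> linarith

theorem norm_sub_le_of_mem_box {θ θ' : Fin J → ℝ} (h : θ ∈ M.box) (h' : θ' ∈ M.box) :
    ‖θ - θ'‖ ≤ ∑ j, |M.width j| := by
  refine (pi_norm_le_iff_of_nonneg (Finset.sum_nonneg fun _ _ => abs_nonneg _)).2 fun j => ?_
  refine (M.norm_sub_le_width (h j) (h' j)).trans ((le_abs_self _).trans ?_)
  exact Finset.single_le_sum (f := fun j => |M.width j|) (fun _ _ => abs_nonneg _)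
    (Finset.mem_univ j)

theorem update_mem_box {θ : Fin J → ℝ} (h : θ ∈ M.box) {j : Fin J} {s : ℝ}
    (hs : s ∈ M.interval j) : Function.update θ j s ∈ M.box := by
  intro i
  rcases eq_or_ne i j with rfl | hi
  · rwa [Function.update_self]
  · rw [Function.update_of_ne hi]; exact h i

/-- The `j`-th partial derivative of the log-likelihood plus the log-prior of the `j`-th unknown,
taken within the search interval. -/
noncomputable def score (j : Fin J) (θ : Fin J → ℝ) : ℝ :=
  derivWithin (fun s => Real.log (M.prior j s) + Real.log (M.lik (Function.update θ j s)))
    (M.interval j) (θ j)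

/-- Replacing the `j`-th entry twice is replacing it once. The gradient thus becomes a weight times
a function of one point of the box, to which the Lipschitz calculus applies. -/
theorem gradP_eq {Np : ℕ} (p w : Particles J Np) (θ : Fin J → ℝ) (j : Fin J) (n : Fin Np) :
    M.gradP p w θ j n = -(w j n) * M.score j (Function.update θ j (p j n)) := by
  simp only [gradP, score, Function.update_idem, Function.update_self]

/-- The interval has at most one point, hence no accumulation point, and `derivWithin` takes its
default value 0. -/
theorem score_eq_zero {j : Fin J} (hj : M.width j ≤ 0) (θ : Fin J → ℝ) : M.score j θ = 0 := by
  refine derivWithin_zero_of_not_accPt fun h => ?_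
  rw [accPt_principal_iff_nhdsWithin] at h
  have hsub : (M.interval j).Subsingleton := by
    rintro s ⟨h1, h2⟩ t ⟨h3, h4⟩
    linarith
  obtain ⟨s, hs⟩ := h.nonempty_of_mem (self_mem_nhdsWithin)
  by_cases hθ : θ j ∈ M.interval j
  · exact hs.2 (hsub hs.1 hθ)
  · have hcl : IsClosed (M.interval j) := isClosed_Icc
    have h1 : θ j ∈ closure (M.interval j \ {θ j}) := mem_closure_iff_nhdsWithin_neBot.2 h
    exact hθ (hcl.closure_subset (closure_mono Set.sdiff_subset h1))

/-- Positive width makes derivatives within the interval unique, so `derivWithin` must agree with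
the chain rule. -/
theorem score_eq {j : Fin J} (hj : 0 < M.width j) {θ : Fin J → ℝ} (hθ : θ ∈ M.box)
    {a' : ℝ →L[ℝ] ℝ}
    (ha : HasFDerivWithinAt (fun s => Real.log (M.prior j s)) a' (M.interval j) (θ j))
    {l' : (Fin J → ℝ) →L[ℝ] ℝ} (hl : HasFDerivWithinAt (fun θ => Real.log (M.lik θ)) l' M.box θ) :
    M.score j θ = a' 1 + l' (Pi.single j 1) := by
  have h1 : HasDerivWithinAt (fun s => Real.log (M.prior j s)) (a' 1) (M.interval j) (θ j) :=
    ha.hasDerivWithinAt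
  have hup : HasDerivWithinAt (Function.update θ j) (Pi.single j (1 : ℝ)) (M.interval j) (θ j) :=
    (hasDerivAt_update θ j (θ j)).hasDerivWithinAt
  have h2 : HasDerivWithinAt (fun s => Real.log (M.lik (Function.update θ j s)))
      (l' (Pi.single j 1)) (M.interval j) (θ j) := by
    have hl' : HasFDerivWithinAt (fun θ => Real.log (M.lik θ)) l' M.box
        (Function.update θ j (θ j)) := by rwa [Function.update_eq_self]
    exact hl'.comp_hasDerivWithinAt (θ j) hup fun s hs => M.update_mem_box hθ hs
  refine (h1.add h2).derivWithin ?_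
  exact uniqueDiffOn_Icc (by linarith) _ (hθ j)

end Model

namespace Model.Regular

variable {J N : ℕ} {M : Model J N}

theorem bddLipOn_log_prior (hM : M.Regular) (j : Fin J) :
    BddLipOn (fun s => Real.log (M.prior j s)) (M.interval j) :=
  ((hM.log_prior j).exists_bddLipOn (fun _ h _ h' => M.norm_sub_le_width h h')
    (M.convex_interval j)).1

theorem bddLipOn_log_lik (hM : M.Regular) : BddLipOn (fun θ => Real.log (M.lik θ)) M.box :=
  (hM.log_lik.exists_bddLipOn (fun _ h _ h' => M.norm_sub_le_of_mem_box h h') M.convex_box).1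

theorem bddLipOn_score (hM : M.Regular) (j : Fin J) : BddLipOn (M.score j) M.box := by
  rcases le_or_gt (M.width j) 0 with hj | hj
  · exact (BddLipOn.const (0 : ℝ)).congr fun θ _ => M.score_eq_zero hj θ
  obtain ⟨_, a', ha, ha'⟩ := (hM.log_prior j).exists_bddLipOn
    (fun _ h _ h' => M.norm_sub_le_width h h') (M.convex_interval j)
  obtain ⟨_, l', hl, hl'⟩ := hM.log_lik.exists_bddLipOn
    (fun _ h _ h' => M.norm_sub_le_of_mem_box h h') M.convex_box
  have h1 : BddLipOn (fun θ : Fin J → ℝ => a' (θ j) 1) M.box :=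
    (ha'.clm_apply 1).comp (A := 1) (g := fun θ : Fin J → ℝ => θ j) (fun θ hθ => hθ j)
      fun x _ y _ => by rw [one_mul]; exact norm_le_pi_norm (x - y) j
  exact (h1.add (hl'.clm_apply (Pi.single j 1))).congr fun θ hθ =>
    M.score_eq hj hθ (ha _ (hθ j)) (hl θ hθ)

theorem lik_pos (hM : M.Regular) (θ : Fin J → ℝ) : 0 < M.lik θ := by
  have := hM.noise_pos
  refine Finset.prod_pos fun n _ => mul_pos ?_ (Real.exp_pos _)
  have := Real.pi_pos
  positivity

end Model.Regular

end PSPVBI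

namespace PSPVBI

/-! ### Sums over joint particles and their marginals. -/

section Marginals

variable {J Np : ℕ}

theorem sum_prod_eq_one {w : Particles J Np} (hw : ∀ j, ∑ n, w j n = 1) :
    ∑ ν : Fin J → Fin Np, ∏ i, w i (ν i) = 1 := by
  have := Finset.prod_univ_sum (fun _ : Fin J => (Finset.univ : Finset (Fin Np))) w
  rw [Fintype.piFinset_univ] at this
  rw [← this]
  exact Finset.prod_eq_one fun j _ => hw j

/-- Freezing the `j`-th index: swap the `j`-th index of `ν` with an independent copy. -/
theorem sum_erase_prod_mul {w : Particles J Np} {j : Fin J} (hw : ∑ n, w j n = 1)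
    (H : (Fin J → Fin Np) → ℝ) :
    ∑ ν : Fin J → Fin Np, (∏ i ∈ Finset.univ.erase j, w i (ν i)) * H ν
      = ∑ n, ∑ ν : Fin J → Fin Np, (∏ i, w i (ν i)) * H (Function.update ν j n) := by
  have hsplit : ∀ ν : Fin J → Fin Np,
      ∏ i, w i (ν i) = w j (ν j) * ∏ i ∈ Finset.univ.erase j, w i (ν i) := fun ν =>
    (Finset.mul_prod_erase _ _ (Finset.mem_univ j)).symm
  have herase : ∀ (ν : Fin J → Fin Np) n, ∏ i ∈ Finset.univ.erase j, w i (Function.update ν j n i)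
      = ∏ i ∈ Finset.univ.erase j, w i (ν i) := fun ν n =>
    Finset.prod_congr rfl fun i hi => by rw [Function.update_of_ne (Finset.ne_of_mem_erase hi)]
  calc ∑ ν : Fin J → Fin Np, (∏ i ∈ Finset.univ.erase j, w i (ν i)) * H ν
      = ∑ n, ∑ ν : Fin J → Fin Np,
          w j n * ((∏ i ∈ Finset.univ.erase j, w i (ν i)) * H ν) := by
        simp_rw [← Finset.mul_sum, ← Finset.sum_mul]
        rw [hw, one_mul]
    _ = ∑ z : Fin Np × (Fin J → Fin Np),
          w j z.1 * ((∏ i ∈ Finset.univ.erase j, w i (z.2 i)) * H z.2) :=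
        (Fintype.sum_prod_type' _).symm
    _ = ∑ z : Fin Np × (Fin J → Fin Np),
          (∏ i, w i (z.2 i)) * H (Function.update z.2 j z.1) := by
        -- Exchanging the free index `n` with `ν j` is an involution; it moves the factor `w j n` to
        -- the missing place in the product.
        refine Finset.sum_nbij' (fun z => (z.2 j, Function.update z.2 j z.1))
          (fun z => (z.2 j, Function.update z.2 j z.1)) (by simp) (by simp) ?_ ?_ ?_
        · rintro ⟨n, ν⟩ -
          simp
        · rintro ⟨n, ν⟩ -
          simp
        · rintro ⟨n, ν⟩ -
          simp only [Function.update_idem, Function.update_eq_self]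
          rw [hsplit, herase, Function.update_self]
          ring
    _ = _ := Fintype.sum_prod_type' fun n ν => (∏ i, w i (ν i)) * H (Function.update ν j n)

theorem sum_prod_mul_marginal {w : Particles J Np} (hw : ∀ j, ∑ n, w j n = 1) (j : Fin J)
    (a : Fin Np → ℝ) :
    ∑ ν : Fin J → Fin Np, (∏ i, w i (ν i)) * a (ν j) = ∑ n, w j n * a n := by
  calc _ = ∑ ν : Fin J → Fin Np,
        (∏ i ∈ Finset.univ.erase j, w i (ν i)) * (w j (ν j) * a (ν j)) := by
        refine Finset.sum_congr rfl fun ν _ => ?_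
        rw [← Finset.mul_prod_erase _ _ (Finset.mem_univ j)]
        ring
    _ = _ := by
        rw [sum_erase_prod_mul (hw j)]
        refine Finset.sum_congr rfl fun n _ => ?_
        simp only [Function.update_self]
        rw [← Finset.sum_mul, sum_prod_eq_one hw, one_mul]

end Marginals

/-- The position of the joint particle selected by `ν`. -/
def jointParticle {J Np : ℕ} (p : Particles J Np) (ν : Fin J → Fin Np) : Fin J → ℝ :=
  fun j => p j (ν j)

theorem jointParticle_update {J Np : ℕ} (p : Particles J Np) (ν : Fin J → Fin Np) (j : Fin J)
    (n : Fin Np) :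
    jointParticle p (Function.update ν j n) = Function.update (jointParticle p ν) j (p j n) := by
  ext i
  rcases eq_or_ne i j with rfl | hi
  · simp [jointParticle]
  · simp [jointParticle, Function.update_of_ne hi]

/-! ### The reduced objective and the mean gradient on the feasible set. -/

namespace Model

variable {J N Np : ℕ} (M : Model J N)

theorem weight_pos (hM : M.Regular) {x : Particles J Np × Particles J Np}
    (hx : x ∈ M.feasible Np) (j : Fin J) (n : Fin Np) : 0 < x.2 j n :=
  hM.eps_pos.trans_le ((hx j).2.2 n).1

theorem jointParticle_mem_box {x : Particles J Np × Particles J Np}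
    (hx : x ∈ M.feasible Np) (ν : Fin J → Fin Np) : jointParticle x.1 ν ∈ M.box :=
  fun j => (hx j).1 (ν j)

theorem feasible_eq : M.feasible Np = {x | (∀ j n, x.1 j n ∈ M.interval j) ∧
    (∀ j, ∑ n, x.2 j n = 1) ∧ ∀ j n, x.2 j n ∈ Set.Icc M.ε 1} := by
  ext x
  simp only [feasible, posSet, weightSet, Set.mem_ofPred_eq, Set.mem_Icc]
  exact ⟨fun h => ⟨fun j => (h j).1, fun j => (h j).2.1, fun j => (h j).2.2⟩,
    fun h j => ⟨h.1 j, h.2.1 j, h.2.2 j⟩⟩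

theorem isClosed_feasible : IsClosed (M.feasible Np) := by
  rw [feasible_eq]
  simp only [Set.ofPred_and, Set.ofPred_forall]
  refine IsClosed.inter ?_ (IsClosed.inter ?_ ?_)
  · exact isClosed_iInter fun j => isClosed_iInter fun n =>
      isClosed_Icc.preimage (f := fun x : Particles J Np × Particles J Np => x.1 j n) (by fun_prop)
  · exact isClosed_iInter fun j => isClosed_eq (by fun_prop) continuous_const
  · exact isClosed_iInter fun j => isClosed_iInter fun n =>
      isClosed_Icc.preimage (f := fun x : Particles J Np × Particles J Np => x.2 j n) (by fun_prop)

theorem convex_posSet (j : Fin J) : Convex ℝ (M.posSet Np j) := by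
  intro x hx y hy a b ha hb hab n
  exact M.convex_interval j (hx n) (hy n) ha hb hab

theorem convex_weightSet : Convex ℝ (M.weightSet Np) := by
  intro x hx y hy a b ha hb hab
  refine ⟨?_, fun n => ?_⟩
  · simp only [Pi.add_apply, Pi.smul_apply, smul_eq_mul, Finset.sum_add_distrib,
      ← Finset.mul_sum, hx.1, hy.1, mul_one, hab]
  · exact convex_Icc M.ε 1 (hx.2 n) (hy.2 n) ha hb hab

theorem convex_feasible : Convex ℝ (M.feasible Np) := by
  intro x hx y hy a b ha hb hab j
  exact ⟨M.convex_posSet j (hx j).1 (hy j).1 ha hb hab,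
    M.convex_weightSet (hx j).2 (hy j).2 ha hb hab⟩

/-- The objective on the feasible set, with the entropy and the prior terms marginalized. -/
noncomputable def reducedObjective (x : Particles J Np × Particles J Np) : ℝ :=
  ∑ j, ∑ n, x.2 j n * (Real.log (x.2 j n) - Real.log (M.prior j (x.1 j n)))
    - ∑ ν : Fin J → Fin Np, (∏ j, x.2 j (ν j)) * Real.log (M.lik (jointParticle x.1 ν))

/-- Positivity lets the logarithm of the quotient split. The entropy and prior terms then depend on
one index each, and the other weights sum to one. -/
theorem objective_eq_reduced (hM : M.Regular) {x : Particles J Np × Particles J Np}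
    (hx : x ∈ M.feasible Np) : M.objective x = M.reducedObjective x := by
  have hw : ∀ j, ∑ n, x.2 j n = 1 := fun j => (hx j).2.1
  have hpos := M.weight_pos hM hx
  have hlog : ∀ ν : Fin J → Fin Np, Real.log ((∏ j, x.2 j (ν j)) /
      (M.lik (fun j => x.1 j (ν j)) * M.jointPrior (fun j => x.1 j (ν j))))
      = ∑ j, (Real.log (x.2 j (ν j)) - Real.log (M.prior j (x.1 j (ν j))))
        - Real.log (M.lik (jointParticle x.1 ν)) := by
    intro ν
    have hpr : ∀ j, 0 < M.prior j (x.1 j (ν j)) := fun j => hM.prior_pos j _ ((hx j).1 (ν j))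
    have hJ : 0 < M.jointPrior (fun j => x.1 j (ν j)) := Finset.prod_pos fun j _ => hpr j
    have hL := hM.lik_pos (fun j => x.1 j (ν j))
    rw [Real.log_div (Finset.prod_pos fun j _ => hpos j _).ne' (mul_pos hL hJ).ne',
      Real.log_mul hL.ne' hJ.ne', jointPrior, Real.log_prod fun j _ => (hpos j _).ne',
      Real.log_prod fun j _ => (hpr j).ne', Finset.sum_sub_distrib]
    change _ = _ - Real.log (M.lik fun j => x.1 j (ν j))
    ring
  have hterm : ∀ ν : Fin J → Fin Np, (∏ j, x.2 j (ν j)) * Real.log ((∏ j, x.2 j (ν j)) /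
      (M.lik (fun j => x.1 j (ν j)) * M.jointPrior (fun j => x.1 j (ν j))))
      = ∑ j, (∏ i, x.2 i (ν i)) *
          (Real.log (x.2 j (ν j)) - Real.log (M.prior j (x.1 j (ν j))))
        - (∏ j, x.2 j (ν j)) * Real.log (M.lik (jointParticle x.1 ν)) := fun ν => by
    rw [hlog, mul_sub, Finset.mul_sum]
  rw [objective, reducedObjective, Finset.sum_congr rfl fun ν _ => hterm ν,
    Finset.sum_sub_distrib, Finset.sum_comm]
  congr 1
  exact Finset.sum_congr rfl fun j _ => sum_prod_mul_marginal hw j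
    fun n => Real.log (x.2 j n) - Real.log (M.prior j (x.1 j n))

/-- The mean of the instantaneous gradients under the particle distribution. -/
noncomputable def meanGrad (x : Particles J Np × Particles J Np) :
    Particles J Np × Particles J Np :=
  (fun j n => ∑ ν : Fin J → Fin Np, (∏ i, x.2 i (ν i)) *
      M.gradP x.1 x.2 (jointParticle x.1 ν) j n,
    fun j n => ∑ ν : Fin J → Fin Np, (∏ i, x.2 i (ν i)) *
      M.gradW x.1 x.2 (jointParticle x.1 ν) j n)

section Regularity

variable {M}

theorem Regular.bddLipOn_pos (j : Fin J) (n : Fin Np) :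
    BddLipOn (fun x : Particles J Np × Particles J Np => x.1 j n) (M.feasible Np) := by
  refine BddLipOn.of_bounds (A := |M.center j| + |M.width j|) (B := 1) (fun x hx => ?_)
    fun x _ y _ => ?_
  · obtain ⟨h1, h2⟩ := (hx j).1 n
    rw [Real.norm_eq_abs, abs_le]
    have := neg_abs_le (M.center j); have := le_abs_self (M.center j)
    have := neg_abs_le (M.width j); have := le_abs_self (M.width j)
    constructor <;> linarith
  · rw [one_mul]
    exact ((norm_le_pi_norm ((x.1 - y.1) j) n).trans (norm_le_pi_norm (x.1 - y.1) j)).trans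
      (norm_fst_le (x - y))

theorem Regular.bddLipOn_weight (hM : M.Regular) (j : Fin J) (n : Fin Np) :
    BddLipOn (fun x : Particles J Np × Particles J Np => x.2 j n) (M.feasible Np) := by
  refine BddLipOn.of_bounds (A := 1) (B := 1) (fun x hx => ?_) fun x _ y _ => ?_
  · rw [Real.norm_of_nonneg (M.weight_pos hM hx j n).le]
    exact ((hx j).2.2 n).2
  · rw [one_mul]
    exact ((norm_le_pi_norm ((x.2 - y.2) j) n).trans (norm_le_pi_norm (x.2 - y.2) j)).trans
      (norm_snd_le (x - y))

theorem Regular.bddLipOn_log_weight (hM : M.Regular) (j : Fin J) (n : Fin Np) :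
    BddLipOn (fun x : Particles J Np × Particles J Np => Real.log (x.2 j n))
      (M.feasible Np) := by
  have hε := hM.eps_pos
  have hlip : LipschitzOnWith (M.ε⁻¹).toNNReal Real.log (Set.Icc M.ε 1) := by
    refine (convex_Icc M.ε 1).lipschitzOnWith_of_nnnorm_hasDerivWithin_le
      (f' := fun s => s⁻¹) (fun s hs => ?_) fun s hs => ?_
    · exact (Real.hasDerivAt_log (hε.trans_le hs.1).ne').hasDerivWithinAt
    · rw [← NNReal.coe_le_coe, Real.coe_toNNReal _ (by positivity), coe_nnnorm,
        Real.norm_of_nonneg (inv_nonneg.2 (hε.trans_le hs.1).le)]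
      exact inv_anti₀ hε hs.1
  have hlog : BddLipOn Real.log (Set.Icc M.ε 1) :=
    bddLipOn_of_lipschitzOnWith (D := |1 - M.ε|) (fun s hs t ht => by
      rw [Real.norm_eq_abs]
      refine (abs_le.2 ⟨?_, ?_⟩).trans (le_abs_self _) <;> linarith [hs.1, hs.2, ht.1, ht.2]) hlip
  obtain ⟨A, _, _, hA⟩ := hM.bddLipOn_weight (Np := Np) j n
  exact hlog.comp (fun x hx => (hx j).2.2 n) hA

theorem Regular.bddLipOn_log_prior_pos (hM : M.Regular) (j : Fin J) (n : Fin Np) :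
    BddLipOn (fun x : Particles J Np × Particles J Np => Real.log (M.prior j (x.1 j n)))
      (M.feasible Np) := by
  obtain ⟨A, _, _, hA⟩ := Regular.bddLipOn_pos (M := M) (Np := Np) j n
  exact (hM.bddLipOn_log_prior j).comp (fun x hx => (hx j).1 n) hA

theorem bddLipOn_comp_jointParticle {φ : (Fin J → ℝ) → ℝ} (hφ : BddLipOn φ M.box)
    (ν : Fin J → Fin Np) :
    BddLipOn (fun x : Particles J Np × Particles J Np => φ (jointParticle x.1 ν))
      (M.feasible Np) := by
  refine hφ.comp (A := 1) (g := fun x => jointParticle x.1 ν)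
    (fun x hx => M.jointParticle_mem_box hx ν) fun x _ y _ => ?_
  rw [one_mul]
  refine (pi_norm_le_iff_of_nonneg (norm_nonneg _)).2 fun j => ?_
  exact ((norm_le_pi_norm ((x.1 - y.1) j) (ν j)).trans (norm_le_pi_norm (x.1 - y.1) j)).trans
    (norm_fst_le (x - y))

theorem Regular.bddLipOn_prod_weight (hM : M.Regular) (ν : Fin J → Fin Np) :
    BddLipOn (fun x : Particles J Np × Particles J Np => ∏ i, x.2 i (ν i)) (M.feasible Np) :=
  BddLipOn.prod _ fun i _ => hM.bddLipOn_weight i (ν i)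

theorem Regular.bddLipOn_objective (hM : M.Regular) :
    BddLipOn (M.objective (Np := Np)) (M.feasible Np) := by
  refine BddLipOn.congr (f := M.reducedObjective) ?_ fun x hx => M.objective_eq_reduced hM hx
  refine BddLipOn.sub (BddLipOn.sum _ fun j _ => BddLipOn.sum _ fun n _ =>
    (hM.bddLipOn_weight j n).mul ((hM.bddLipOn_log_weight j n).sub
      (hM.bddLipOn_log_prior_pos j n))) (BddLipOn.sum _ fun ν _ =>
    (hM.bddLipOn_prod_weight ν).mul (bddLipOn_comp_jointParticle hM.bddLipOn_log_lik ν))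

theorem Regular.bddLipOn_meanGrad (hM : M.Regular) :
    BddLipOn (M.meanGrad (Np := Np)) (M.feasible Np) := by
  refine BddLipOn.prodMk (BddLipOn.pi fun j => BddLipOn.pi fun n => ?_)
    (BddLipOn.pi fun j => BddLipOn.pi fun n => ?_)
  · refine BddLipOn.sum _ fun ν _ => (hM.bddLipOn_prod_weight ν).mul ?_
    simp only [gradP_eq, ← jointParticle_update]
    exact (hM.bddLipOn_weight j n).neg.mul
      (bddLipOn_comp_jointParticle (hM.bddLipOn_score j) (Function.update ν j n))
  · refine BddLipOn.sum _ fun ν _ => (hM.bddLipOn_prod_weight ν).mul ?_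
    simp only [gradW, ← jointParticle_update]
    exact (((hM.bddLipOn_log_weight j n).add (BddLipOn.const 1)).sub
      (hM.bddLipOn_log_prior_pos j n)).sub
      (bddLipOn_comp_jointParticle hM.bddLipOn_log_lik (Function.update ν j n))

end Regularity

end Model

end PSPVBI

namespace PSPVBI

open scoped RealInnerProductSpace

/-! ### Euclidean coordinates, and the gradient of the objective. -/

section Flatten

variable {J Np : ℕ}

/-- Positions and weights as one vector of a Euclidean space. -/
noncomputable def flatten (J Np : ℕ) : (Particles J Np × Particles J Np) ≃L[ℝ]
    EuclideanSpace ℝ ((Fin J × Fin Np) ⊕ (Fin J × Fin Np)) :=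
  LinearEquiv.toContinuousLinearEquiv
    { toFun := fun x => WithLp.toLp 2 (Sum.elim (fun a => x.1 a.1 a.2) fun a => x.2 a.1 a.2)
      invFun := fun v => (fun j n => v (Sum.inl (j, n)), fun j n => v (Sum.inr (j, n)))
      map_add' := fun x y => by
        ext a
        rcases a with a | a <;> rfl
      map_smul' := fun r x => by
        ext a
        rcases a with a | a <;> rfl
      left_inv := fun x => rfl
      right_inv := fun v => by
        ext a
        rcases a with a | a <;> rfl }

theorem flatten_inl (x : Particles J Np × Particles J Np) (a : Fin J × Fin Np) :
    flatten J Np x (Sum.inl a) = x.1 a.1 a.2 := rfl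

theorem flatten_inr (x : Particles J Np × Particles J Np) (a : Fin J × Fin Np) :
    flatten J Np x (Sum.inr a) = x.2 a.1 a.2 := rfl

theorem inner_flatten (x y : Particles J Np × Particles J Np) :
    ⟪flatten J Np x, flatten J Np y⟫
      = ∑ j, ∑ n, x.1 j n * y.1 j n + ∑ j, ∑ n, x.2 j n * y.2 j n := by
  rw [PiLp.inner_apply, Fintype.sum_sum_type]
  simp only [flatten_inl, flatten_inr, Fintype.sum_prod_type]
  congr 1 <;>
  exact Finset.sum_congr rfl fun j _ => Finset.sum_congr rfl fun n _ => mul_comm _ _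

/-- The functional `v ↦ ⟨g, v⟩` of the Euclidean inner product on positions and weights. -/
noncomputable def pairing (g : Particles J Np × Particles J Np) :
    (Particles J Np × Particles J Np) →L[ℝ] ℝ :=
  (innerSL ℝ (flatten J Np g)).comp (flatten J Np).toContinuousLinearMap

theorem pairing_apply (g v : Particles J Np × Particles J Np) :
    pairing g v = ⟪flatten J Np g, flatten J Np v⟫ := rfl

theorem pairing_sub (g g' : Particles J Np × Particles J Np) :
    pairing (g - g') = pairing g - pairing g' := by
  refine ContinuousLinearMap.ext fun v => ?_
  simp only [pairing_apply, map_sub, inner_sub_left, _root_.sub_apply]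

/-- Pairs of particle families carry the sup norm while the gradient acts through the Euclidean
inner product; the square of the norm of `flatten` converts between them. -/
theorem norm_pairing_le (g : Particles J Np × Particles J Np) :
    ‖pairing g‖ ≤ ‖(flatten J Np).toContinuousLinearMap‖ ^ 2 * ‖g‖ := by
  have h1 := (flatten J Np).toContinuousLinearMap.le_opNorm g
  refine (ContinuousLinearMap.opNorm_comp_le _ _).trans ?_
  rw [innerSL_apply_norm]
  calc _ ≤ (‖(flatten J Np).toContinuousLinearMap‖ * ‖g‖)
        * ‖(flatten J Np).toContinuousLinearMap‖ :=
        mul_le_mul_of_nonneg_right h1 (norm_nonneg _)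
    _ = _ := by ring

end Flatten

namespace Model

variable {J N Np : ℕ} {M : Model J N}

/-- The coordinate functional of the position `p j n`. -/
noncomputable def posCoord (j : Fin J) (n : Fin Np) :
    (Particles J Np × Particles J Np) →L[ℝ] ℝ :=
  ((ContinuousLinearMap.proj n).comp (ContinuousLinearMap.proj j)).comp
    (ContinuousLinearMap.fst ℝ (Particles J Np) (Particles J Np))

/-- The coordinate functional of the weight `w j n`. -/
noncomputable def weightCoord (j : Fin J) (n : Fin Np) :
    (Particles J Np × Particles J Np) →L[ℝ] ℝ :=
  ((ContinuousLinearMap.proj n).comp (ContinuousLinearMap.proj j)).comp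
    (ContinuousLinearMap.snd ℝ (Particles J Np) (Particles J Np))

theorem posCoord_apply (j : Fin J) (n : Fin Np) (x : Particles J Np × Particles J Np) :
    posCoord j n x = x.1 j n := rfl

theorem weightCoord_apply (j : Fin J) (n : Fin Np) (x : Particles J Np × Particles J Np) :
    weightCoord j n x = x.2 j n := rfl

/-- Within the feasible set, the mean of the instantaneous gradients is the gradient of the
objective. -/
theorem Regular.hasFDerivWithinAt_objective (hM : M.Regular)
    {x : Particles J Np × Particles J Np} (hx : x ∈ M.feasible Np) :
    HasFDerivWithinAt M.objective (pairing (M.meanGrad x)) (M.feasible Np) x := by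
  have hw : ∀ j, ∑ n, x.2 j n = 1 := fun j => (hx j).2.1
  choose a' ka ha hka using hM.log_prior
  obtain ⟨l', kl, hl, hkl⟩ := hM.log_lik
  have hP : ∀ j n, HasFDerivWithinAt (fun y : Particles J Np × Particles J Np => y.1 j n)
      (posCoord j n) (M.feasible Np) x := fun j n => (posCoord j n).hasFDerivWithinAt
  have hW : ∀ j n, HasFDerivWithinAt (fun y : Particles J Np × Particles J Np => y.2 j n)
      (weightCoord j n) (M.feasible Np) x := fun j n => (weightCoord j n).hasFDerivWithinAt
  have hlogW : ∀ j n, HasFDerivWithinAt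
      (fun y : Particles J Np × Particles J Np => Real.log (y.2 j n))
      ((x.2 j n)⁻¹ • weightCoord j n) (M.feasible Np) x := fun j n =>
    (hW j n).log (M.weight_pos hM hx j n).ne'
  have hprior : ∀ j n, HasFDerivWithinAt
      (fun y : Particles J Np × Particles J Np => Real.log (M.prior j (y.1 j n)))
      ((a' j (x.1 j n)).comp (posCoord j n)) (M.feasible Np) x := fun j n =>
    HasFDerivWithinAt.comp (g := fun s => Real.log (M.prior j s)) (t := M.interval j) x
      (ha j _ ((hx j).1 n)) (hP j n) fun y hy => (hy j).1 n
  have hpart : ∀ ν : Fin J → Fin Np, HasFDerivWithinAt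
      (fun y : Particles J Np × Particles J Np => jointParticle y.1 ν)
      (ContinuousLinearMap.pi fun j => posCoord j (ν j)) (M.feasible Np) x := fun ν =>
    (ContinuousLinearMap.pi fun j => posCoord j (ν j)).hasFDerivWithinAt
  have hlik : ∀ ν : Fin J → Fin Np, HasFDerivWithinAt
      (fun y : Particles J Np × Particles J Np => Real.log (M.lik (jointParticle y.1 ν)))
      ((l' (jointParticle x.1 ν)).comp (ContinuousLinearMap.pi fun j => posCoord j (ν j)))
      (M.feasible Np) x := fun ν =>
    HasFDerivWithinAt.comp (g := fun θ => Real.log (M.lik θ)) (t := M.box) x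
      (hl _ (M.jointParticle_mem_box hx ν)) (hpart ν) fun y hy => M.jointParticle_mem_box hy ν
  have hprod : ∀ ν : Fin J → Fin Np, HasFDerivWithinAt
      (fun y : Particles J Np × Particles J Np => ∏ j, y.2 j (ν j))
      (∑ j, (∏ i ∈ Finset.univ.erase j, x.2 i (ν i)) • weightCoord j (ν j))
      (M.feasible Np) x := fun ν =>
    HasFDerivWithinAt.finsetProd fun j _ => hW j (ν j)
  have hred := (HasFDerivWithinAt.fun_sum (u := Finset.univ) fun j _ =>
    HasFDerivWithinAt.fun_sum (u := Finset.univ) fun n _ =>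
      (hW j n).mul ((hlogW j n).sub (hprior j n))).sub
    (HasFDerivWithinAt.fun_sum (u := Finset.univ) fun ν _ => (hprod ν).mul (hlik ν))
  have hobj := hred.congr (f₁ := M.objective)
    (fun y hy => M.objective_eq_reduced hM hy) (M.objective_eq_reduced hM hx)
  -- The product rule yields a functional that may differ from the pairing off the feasible
  -- directions, because `score` takes a default value on degenerate intervals. Agreement on `y - x`
  -- is enough.
  refine hobj.congr_on_directions fun y hy => ?_
  set v := y - x with hv
  -- the partial derivatives in the positions agree along feasible directions
  have hscore : ∀ (ν : Fin J → Fin Np) j n, v.1 j n * M.score j (jointParticle x.1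
      (Function.update ν j n)) = v.1 j n * (a' j (x.1 j n) 1
        + l' (jointParticle x.1 (Function.update ν j n)) (Pi.single j 1)) := by
    intro ν j n
    -- On a degenerate interval two feasible positions coincide, so both sides vanish whatever the
    -- value of `score`.
    rcases le_or_gt (M.width j) 0 with hj | hj
    · have h1 := M.norm_sub_le_width ((hy j).1 n) ((hx j).1 n)
      have h2 : v.1 j n = 0 := norm_le_zero_iff.1 (h1.trans hj)
      rw [h2, zero_mul, zero_mul]
    · have hmem := M.jointParticle_mem_box hx (Function.update ν j n)
      have hcoord : jointParticle x.1 (Function.update ν j n) j = x.1 j n := by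
        simp [jointParticle]
      rw [M.score_eq hj hmem (a' := a' j (x.1 j n)) (by rw [hcoord]; exact ha j _ ((hx j).1 n))
        (hl _ hmem)]
  have hl_sum : ∀ ν : Fin J → Fin Np, l' (jointParticle x.1 ν) (fun j => v.1 j (ν j))
      = ∑ j, v.1 j (ν j) * l' (jointParticle x.1 ν) (Pi.single j 1) := by
    intro ν
    conv_lhs => rw [pi_eq_sum_univ' (fun j => v.1 j (ν j))]
    rw [map_sum]
    refine Finset.sum_congr rfl fun j _ => ?_
    rw [map_smul, smul_eq_mul]
  have ha_lin : ∀ j n, a' j (x.1 j n) (v.1 j n) = v.1 j n * a' j (x.1 j n) 1 := by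
    intro j n
    conv_lhs => rw [← mul_one (v.1 j n), ← smul_eq_mul, map_smul, smul_eq_mul]
  -- Differentiating in a weight of the `j`-th unknown deletes its factor. `sum_erase_prod_mul`
  -- restores it by averaging over an independent `j`-th index, which turns the partial derivative
  -- into an expectation under the full particle law.
  have hpart_w : ∀ j, ∑ ν : Fin J → Fin Np, (∏ i ∈ Finset.univ.erase j, x.2 i (ν i))
      * (v.2 j (ν j) * Real.log (M.lik (jointParticle x.1 ν)))
      = ∑ n, ∑ ν : Fin J → Fin Np, (∏ i, x.2 i (ν i)) *
        (v.2 j n * Real.log (M.lik (jointParticle x.1 (Function.update ν j n)))) := by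
    intro j
    rw [sum_erase_prod_mul (hw j)]
    simp only [Function.update_self]
  have hpart_p : ∀ j, ∑ ν : Fin J → Fin Np, (∏ i, x.2 i (ν i))
      * (v.1 j (ν j) * l' (jointParticle x.1 ν) (Pi.single j 1))
      = ∑ n, ∑ ν : Fin J → Fin Np, (∏ i, x.2 i (ν i)) * (x.2 j n *
        (v.1 j n * l' (jointParticle x.1 (Function.update ν j n)) (Pi.single j 1))) := by
    intro j
    have := sum_erase_prod_mul (hw j) (fun ν => x.2 j (ν j) *
      (v.1 j (ν j) * l' (jointParticle x.1 ν) (Pi.single j 1)))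
    simp only [Function.update_self] at this
    rw [← this]
    refine Finset.sum_congr rfl fun ν _ => ?_
    rw [← Finset.mul_prod_erase _ _ (Finset.mem_univ j)]
    ring
  -- Terms free of `ν` are written as averages, so that they can be compared under the same sum as
  -- the likelihood terms.
  have hconst : ∀ a : ℝ, a = ∑ ν : Fin J → Fin Np, (∏ i, x.2 i (ν i)) * a := fun a => by
    rw [← Finset.sum_mul, sum_prod_eq_one hw, one_mul]
  have hG1 : ∀ j n, (M.meanGrad x).1 j n * v.1 j n = -(x.2 j n * (v.1 j n * a' j (x.1 j n) 1))
      - ∑ ν : Fin J → Fin Np, (∏ i, x.2 i (ν i)) * (x.2 j n *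
        (v.1 j n * l' (jointParticle x.1 (Function.update ν j n)) (Pi.single j 1))) := by
    intro j n
    rw [hconst (x.2 j n * (v.1 j n * a' j (x.1 j n) 1)), meanGrad]
    simp only [gradP_eq, ← jointParticle_update]
    rw [Finset.sum_mul, ← Finset.sum_neg_distrib, ← Finset.sum_sub_distrib]
    refine Finset.sum_congr rfl fun ν _ => ?_
    linear_combination (-(∏ i, x.2 i (ν i)) * x.2 j n) * hscore ν j n
  have hG2 : ∀ j n, (M.meanGrad x).2 j n * v.2 j n
      = v.2 j n * (Real.log (x.2 j n) + 1 - Real.log (M.prior j (x.1 j n)))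
      - ∑ ν : Fin J → Fin Np, (∏ i, x.2 i (ν i)) *
        (v.2 j n * Real.log (M.lik (jointParticle x.1 (Function.update ν j n)))) := by
    intro j n
    rw [hconst (v.2 j n * (Real.log (x.2 j n) + 1 - Real.log (M.prior j (x.1 j n)))), meanGrad]
    simp only [gradW, ← jointParticle_update]
    rw [Finset.sum_mul, ← Finset.sum_sub_distrib]
    exact Finset.sum_congr rfl fun ν _ => by ring
  rw [pairing_apply, inner_flatten]
  simp only [hG1, hG2, Finset.sum_sub_distrib]
  simp only [← hpart_w, ← hpart_p]
  have hlik_p : ∑ ν : Fin J → Fin Np, (∏ i, x.2 i (ν i)) *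
      l' (jointParticle x.1 ν) (fun j => v.1 j (ν j))
      = ∑ j, ∑ ν : Fin J → Fin Np, (∏ i, x.2 i (ν i))
        * (v.1 j (ν j) * l' (jointParticle x.1 ν) (Pi.single j 1)) := by
    simp only [hl_sum, Finset.mul_sum]
    exact Finset.sum_comm
  have hlik_w : ∑ ν : Fin J → Fin Np, Real.log (M.lik (jointParticle x.1 ν)) *
      ∑ j, (∏ i ∈ Finset.univ.erase j, x.2 i (ν i)) * v.2 j (ν j)
      = ∑ j, ∑ ν : Fin J → Fin Np, (∏ i ∈ Finset.univ.erase j, x.2 i (ν i))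
        * (v.2 j (ν j) * Real.log (M.lik (jointParticle x.1 ν))) := by
    simp only [Finset.mul_sum]
    rw [Finset.sum_comm]
    exact Finset.sum_congr rfl fun j _ => Finset.sum_congr rfl fun ν _ => by ring
  -- The summand 1 next to the logarithm is the derivative of `w * log w` falling on the logarithm:
  -- `w * w⁻¹ = 1`.
  have hmarg : ∑ j, ∑ n, (x.2 j n * ((x.2 j n)⁻¹ * v.2 j n - a' j (x.1 j n) (v.1 j n))
      + (Real.log (x.2 j n) - Real.log (M.prior j (x.1 j n))) * v.2 j n)
      = ∑ j, ∑ n, -(x.2 j n * (v.1 j n * a' j (x.1 j n) 1))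
        + ∑ j, ∑ n, v.2 j n * (Real.log (x.2 j n) + 1 - Real.log (M.prior j (x.1 j n))) := by
    simp only [← Finset.sum_add_distrib]
    refine Finset.sum_congr rfl fun j _ => Finset.sum_congr rfl fun n _ => ?_
    have := (M.weight_pos hM hx j n).ne'
    rw [ha_lin]
    field_simp
    ring
  rw [← hlik_p, ← hlik_w, sub_add_sub_comm, ← hmarg, ← Finset.sum_add_distrib]
  simp only [_root_.sub_apply, _root_.sum_apply,
    _root_.add_apply, _root_.smul_apply, smul_eq_mul,
    ContinuousLinearMap.comp_apply, posCoord_apply, weightCoord_apply, Pi.sub_apply]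
  rfl

/-- Quadratic upper bound for the objective on the feasible set. -/
theorem Regular.exists_objective_upper_bound (hM : M.Regular) :
    ∃ C : ℝ, 0 ≤ C ∧ ∀ x ∈ M.feasible Np, ∀ y ∈ M.feasible Np,
      M.objective y ≤ M.objective x + pairing (M.meanGrad x) (y - x) + C * ‖y - x‖ ^ 2 := by
  obtain ⟨C, hC, _, hG⟩ := hM.bddLipOn_meanGrad (Np := Np)
  set A := ‖(flatten J Np).toContinuousLinearMap‖ ^ 2
  have hA : 0 ≤ A := sq_nonneg _
  refine ⟨A * C, by positivity, fun x hx y hy => ?_⟩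
  have hseg : segment ℝ x y ⊆ M.feasible Np := M.convex_feasible.segment_subset hx hy
  -- Mean value inequality for the objective minus its linearization at `x`: along the segment its
  -- derivative is bounded by the Lipschitz constant of the gradient times `‖y - x‖`.
  have hmvt := (convex_segment x y).norm_image_sub_le_of_norm_hasFDerivWithin_le'
    (f := M.objective) (f' := fun z => pairing (M.meanGrad z)) (φ := pairing (M.meanGrad x))
    (C := A * (C * ‖y - x‖))
    (fun z hz => (hM.hasFDerivWithinAt_objective (hseg hz)).mono hseg)
    (fun z hz => by
      rw [← pairing_sub]
      refine (norm_pairing_le _).trans (mul_le_mul_of_nonneg_left ?_ hA)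
      refine (hG z (hseg hz) x hx).trans (mul_le_mul_of_nonneg_left ?_ hC)
      exact norm_sub_le_of_mem_segment hz)
    (left_mem_segment ℝ x y) (right_mem_segment ℝ x y)
  have h1 := (le_abs_self _).trans hmvt
  have h2 : A * (C * ‖y - x‖) * ‖y - x‖ = A * C * ‖y - x‖ ^ 2 := by ring
  linarith

end Model

end PSPVBI

namespace PSPVBI

open scoped RealInnerProductSpace

/-! ### Variational inequalities of the projected step. -/

section Projection

/-- The variational inequality of the Euclidean projection onto a convex set. -/
theorem IsProj.sum_mul_le {n : ℕ} {S : Set (Fin n → ℝ)} (hS : Convex ℝ S) {x y : Fin n → ℝ}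
    (h : IsProj S x y) {z : Fin n → ℝ} (hz : z ∈ S) :
    ∑ i, (x i - y i) * (z i - y i) ≤ 0 := by
  by_contra! hlt
  set q := ∑ i, (x i - y i) * (z i - y i) with hq
  set r := ∑ i, (z i - y i) ^ 2 with hr
  have hr0 : 0 ≤ r := Finset.sum_nonneg fun i _ => sq_nonneg _
  have key : ∀ s ∈ Set.Icc (0 : ℝ) 1, 2 * s * q ≤ s ^ 2 * r := by
    intro s hs
    have hmem : y + s • (z - y) ∈ S := hS.add_smul_sub_mem h.1 hz hs
    have h1 := h.2 _ hmem
    have h2 : ∑ i, (x i - (y + s • (z - y)) i) ^ 2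
        = ∑ i, (x i - y i) ^ 2 - 2 * s * q + s ^ 2 * r := by
      rw [hq, hr, Finset.mul_sum, Finset.mul_sum, ← Finset.sum_sub_distrib,
        ← Finset.sum_add_distrib]
      refine Finset.sum_congr rfl fun i _ => ?_
      simp only [Pi.add_apply, Pi.smul_apply, Pi.sub_apply, smul_eq_mul]
      ring
    linarith
  -- A positive `q` is contradicted by moving from `y` towards `z` by this fraction, which is
  -- positive, at most 1, and well defined even if `r = 0`.
  have hs : q / (q + r) ∈ Set.Icc (0 : ℝ) 1 :=
    ⟨by positivity, (div_le_one (by positivity)).2 (by linarith)⟩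
  have h3 := key _ hs
  have h4 : 0 < q / (q + r) := by positivity
  have h5 : q / (q + r) * (q + r) = q := div_mul_cancel₀ _ (by positivity)
  have h6 : 2 * q ≤ q / (q + r) * r := by
    refine le_of_mul_le_mul_left ?_ h4
    linarith
  nlinarith

/-- The projected step is optimal up to the length of the step. -/
theorem IsProj.sum_step_le {n : ℕ} {S : Set (Fin n → ℝ)} (hS : Convex ℝ S) {p g y : Fin n → ℝ}
    {Γ : ℝ} (hΓ : 0 < Γ) (h : IsProj S (fun i => p i - Γ * g i) y) {z : Fin n → ℝ} (hz : z ∈ S) :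
    ∑ i, g i * (y i - z i) ≤ Γ⁻¹ * ∑ i, (p i - y i) * (y i - z i) := by
  have h1 := h.sum_mul_le hS hz
  have h2 : ∑ i, (p i - Γ * g i - y i) * (z i - y i)
      = Γ * ∑ i, g i * (y i - z i) - ∑ i, (p i - y i) * (y i - z i) := by
    rw [Finset.mul_sum, ← Finset.sum_sub_distrib]
    exact Finset.sum_congr rfl fun i _ => by ring
  rw [h2] at h1
  rw [inv_mul_eq_div, le_div_iff₀ hΓ]
  linarith

theorem IsProj.sum_step_self_le {n : ℕ} {S : Set (Fin n → ℝ)} (hS : Convex ℝ S)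
    {p g y : Fin n → ℝ} {Γ Γ' : ℝ} (hΓ : 0 < Γ) (hΓ' : Γ ≤ Γ')
    (h : IsProj S (fun i => p i - Γ * g i) y) (hp : p ∈ S) :
    ∑ i, g i * (y i - p i) ≤ -Γ'⁻¹ * ∑ i, (y i - p i) * (y i - p i) := by
  refine (h.sum_step_le hS hΓ hp).trans ?_
  have h1 : ∑ i, (p i - y i) * (y i - p i) = -∑ i, (y i - p i) * (y i - p i) := by
    rw [← Finset.sum_neg_distrib]
    exact Finset.sum_congr rfl fun i _ => by ring
  have h2 : 0 ≤ ∑ i, (y i - p i) * (y i - p i) :=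
    Finset.sum_nonneg fun i _ => mul_self_nonneg _
  have h3 := mul_le_mul_of_nonneg_right (inv_anti₀ hΓ hΓ') h2
  rw [h1]
  linarith

theorem IsProj.sum_step_le_of_bound {n : ℕ} {S : Set (Fin n → ℝ)} (hS : Convex ℝ S)
    {p g y : Fin n → ℝ} {Γ Γ₀ : ℝ} (hΓ₀ : 0 < Γ₀) (hΓ : Γ₀ ≤ Γ)
    (h : IsProj S (fun i => p i - Γ * g i) y) {z : Fin n → ℝ} (hz : z ∈ S) {a b : ℝ}
    (ha : ∀ i, |y i - p i| ≤ a) (hb : ∀ i, |y i - z i| ≤ b) :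
    ∑ i, g i * (y i - z i) ≤ Γ₀⁻¹ * (n * (a * b)) := by
  refine (h.sum_step_le hS (hΓ₀.trans_le hΓ) hz).trans ?_
  have h1 : ∑ i, (p i - y i) * (y i - z i) ≤ ∑ _ : Fin n, a * b := by
    refine Finset.sum_le_sum fun i _ => (le_abs_self _).trans ?_
    rw [abs_mul, abs_sub_comm (p i)]
    exact mul_le_mul (ha i) (hb i) (abs_nonneg _) ((abs_nonneg _).trans (ha i))
  have h2 : 0 ≤ (n : ℝ) * (a * b) := by
    rcases Nat.eq_zero_or_pos n with rfl | hn
    · simp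
    · have := (abs_nonneg _).trans (ha ⟨0, hn⟩)
      have := (abs_nonneg _).trans (hb ⟨0, hn⟩)
      positivity
  rw [Finset.sum_const, Finset.card_univ, Fintype.card_fin, nsmul_eq_mul] at h1
  have hpos := hΓ₀.trans_le hΓ
  calc Γ⁻¹ * ∑ i, (p i - y i) * (y i - z i) ≤ Γ⁻¹ * (n * (a * b)) := by gcongr
    _ ≤ _ := mul_le_mul_of_nonneg_right (inv_anti₀ hΓ₀ hΓ) h2

end Projection

/-! ### Sampled gradients, and the conditional law of the samples along a run. -/

namespace Model

variable {J N Np : ℕ} (M : Model J N)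

/-- The instantaneous gradient at the iterate `z.1` and the sample `z.2`. -/
noncomputable def sampleGrad (z : (Particles J Np × Particles J Np) × (Fin J → ℝ)) :
    Particles J Np × Particles J Np :=
  (M.gradP z.1.1 z.1.2 z.2, M.gradW z.1.1 z.1.2 z.2)

theorem meanGrad_eq_sum (x : Particles J Np × Particles J Np) :
    M.meanGrad x = ∑ ν : Fin J → Fin Np,
      (∏ i, x.2 i (ν i)) • M.sampleGrad (x, jointParticle x.1 ν) := by
  ext j n <;> simp [meanGrad, sampleGrad, Prod.fst_sum, Prod.snd_sum]

variable {M}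

/-- Joint control in iterate and sample serves twice: it bounds the noise, and continuity on a
closed set yields measurability. -/
theorem Regular.bddLipOn_sampleGrad (hM : M.Regular) :
    BddLipOn (M.sampleGrad (Np := Np)) (M.feasible Np ×ˢ M.box) := by
  have lift : ∀ {g : Particles J Np × Particles J Np → ℝ}, BddLipOn g (M.feasible Np) →
      BddLipOn (fun z : (Particles J Np × Particles J Np) × (Fin J → ℝ) => g z.1)
        (M.feasible Np ×ˢ M.box) := fun hg =>
    hg.comp (A := 1) (g := Prod.fst) (fun z hz => hz.1) fun z _ z' _ => by
      rw [one_mul]; exact norm_fst_le (z - z')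
  have upd : ∀ {φ : (Fin J → ℝ) → ℝ}, BddLipOn φ M.box → ∀ (j : Fin J) (n : Fin Np),
      BddLipOn (fun z : (Particles J Np × Particles J Np) × (Fin J → ℝ) =>
        φ (Function.update z.2 j (z.1.1 j n))) (M.feasible Np ×ˢ M.box) := fun hφ j n =>
    hφ.comp (A := 1) (g := fun z : (Particles J Np × Particles J Np) × (Fin J → ℝ) =>
      Function.update z.2 j (z.1.1 j n))
      (fun z hz => M.update_mem_box hz.2 ((hz.1 j).1 n)) fun z _ z' _ => by
        rw [one_mul]
        refine (pi_norm_le_iff_of_nonneg (norm_nonneg _)).2 fun i => ?_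
        rcases eq_or_ne i j with rfl | hi
        · simp only [Pi.sub_apply, Function.update_self]
          exact (((norm_le_pi_norm ((z.1.1 - z'.1.1) i) n).trans
            (norm_le_pi_norm (z.1.1 - z'.1.1) i)).trans (norm_fst_le (z.1 - z'.1))).trans
            (norm_fst_le (z - z'))
        · simp only [Pi.sub_apply, Function.update_of_ne hi]
          exact (norm_le_pi_norm (z.2 - z'.2) i).trans (norm_snd_le (z - z'))
  refine BddLipOn.prodMk (BddLipOn.pi fun j => BddLipOn.pi fun n => ?_)
    (BddLipOn.pi fun j => BddLipOn.pi fun n => ?_)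
  · simp only [gradP_eq]
    exact (lift (hM.bddLipOn_weight j n)).neg.mul (upd (hM.bddLipOn_score j) j n)
  · simp only [gradW]
    exact (((lift (hM.bddLipOn_log_weight j n)).add (BddLipOn.const 1)).sub
      (lift (hM.bddLipOn_log_prior_pos j n))).sub (upd hM.bddLipOn_log_lik j n)

theorem Regular.bddLipOn_id (hM : M.Regular) :
    BddLipOn (fun x : Particles J Np × Particles J Np => x) (M.feasible Np) :=
  BddLipOn.prodMk (BddLipOn.pi fun j => BddLipOn.pi fun n => Regular.bddLipOn_pos j n)
    (BddLipOn.pi fun j => BddLipOn.pi fun n => hM.bddLipOn_weight j n)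

end Model

theorem measurable_comp_of_continuousOn {Ω X Y : Type*} {m : MeasurableSpace Ω}
    [TopologicalSpace X] [MeasurableSpace X] [BorelSpace X] [TopologicalSpace Y]
    [MeasurableSpace Y] [BorelSpace Y] {g : X → Y} {s : Set X} (hg : ContinuousOn g s)
    {x : Ω → X} (hx : Measurable x) (hs : ∀ ω, x ω ∈ s) : Measurable fun ω => g (x ω) :=
  hg.domRestrict.measurable.comp (hx.subtype_mk (h := hs))

namespace IsRun

variable {J N Np B : ℕ} {M : Model J N} {ρ γ : ℕ → ℝ} {Γp Γw : ℕ → Fin J → ℝ}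
  {Ω : Type*} {mΩ : MeasurableSpace Ω} {μ : Measure Ω} {ℱ : Filtration ℕ mΩ}
  {p w fp fw pbar wbar : ℕ → Ω → Particles J Np} {θ : ℕ → Ω → Fin B → Fin J → ℝ}

theorem bar_mem (h : IsRun M ρ γ Γp Γw μ ℱ p w fp fw pbar wbar θ) (t : ℕ) (ω : Ω) :
    (pbar t ω, wbar t ω) ∈ M.feasible Np :=
  fun j => ⟨(h.pbar_proj t ω j).1, (h.wbar_proj t ω j).1⟩

theorem succ_eq (h : IsRun M ρ γ Γp Γw μ ℱ p w fp fw pbar wbar θ) (t : ℕ) (ω : Ω) :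
    (p (t + 1) ω, w (t + 1) ω)
      = (p t ω, w t ω) + γ t • ((pbar t ω, wbar t ω) - (p t ω, w t ω)) := by
  ext j n
  · simp only [h.p_succ, Prod.fst_add, Prod.smul_fst, Prod.fst_sub, Pi.add_apply, Pi.smul_apply,
      Pi.sub_apply, smul_eq_mul]
    ring
  · simp only [h.w_succ, Prod.snd_add, Prod.smul_snd, Prod.snd_sub, Pi.add_apply, Pi.smul_apply,
      Pi.sub_apply, smul_eq_mul]
    ring

theorem mem (h : IsRun M ρ γ Γp Γw μ ℱ p w fp fw pbar wbar θ) (hst : StepRules ρ γ) (t : ℕ)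
    (ω : Ω) : (p t ω, w t ω) ∈ M.feasible Np := by
  induction t with
  | zero => exact h.init ω
  | succ t ih =>
    rw [h.succ_eq]
    exact M.convex_feasible.add_smul_sub_mem ih (h.bar_mem t ω) (hst.gamma_mem t)

theorem measurable_iterate (h : IsRun M ρ γ Γp Γw μ ℱ p w fp fw pbar wbar θ) (t : ℕ) :
    Measurable[ℱ t] fun ω => (p t ω, w t ω) :=
  (h.adapted_p t).prodMk (h.adapted_w t)

theorem measurable_sample (h : IsRun M ρ γ Γp Γw μ ℱ p w fp fw pbar wbar θ) (t : ℕ) (b : Fin B) :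
    Measurable[ℱ (t + 1)] fun ω => θ t ω b :=
  (measurable_pi_apply b).comp (h.adapted_sample t)

/-- The conditional law of one sample of the mini-batch. -/
theorem condExp_sample_indicator (h : IsRun M ρ γ Γp Γw μ ℱ p w fp fw pbar wbar θ)
    (hM : M.Regular) (hst : StepRules ρ γ) (t : ℕ) (b : Fin B) {A : Set (Fin J → ℝ)}
    (hA : MeasurableSet A) :
    μ[((fun ω => θ t ω b) ⁻¹' A).indicator (fun _ => (1 : ℝ)) | ℱ t] =ᵐ[μ]
      fun ω => ∑ ν : Fin J → Fin Np, (∏ i, w t ω i (ν i)) *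
        A.indicator (fun _ => 1) (jointParticle (p t ω) ν) := by
  have hA' : MeasurableSet ((fun z : Fin B → Fin J → ℝ => z b) ⁻¹' A) := measurable_pi_apply b hA
  refine (h.sample_law t _ hA').trans (Eventually.of_forall fun ω => ?_)
  have hx := h.mem hst t ω
  have h0 : ∀ j n, 0 ≤ w t ω j n := fun j n => (M.weight_pos hM hx j n).le
  have h1 : ∀ j, ∑ n, w t ω j n = 1 := fun j => (hx j).2.1
  have := isProbabilityMeasure_particleLaw (p := p t ω) h0 h1
  have h2 := (measurePreserving_eval (fun _ : Fin B => particleLaw (p t ω) (w t ω)) b).measure_preimage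
    hA.nullMeasurableSet
  have h3 := particleLaw_real_apply (p := p t ω) h0 h1 hA
  simp only [Measure.real] at h3 ⊢
  exact (congrArg ENNReal.toReal h2).trans h3

variable [IsProbabilityMeasure μ]

/-- All joint particles lie in the box and their weights sum to one, so the conditional probability
of the box is 1. -/
theorem ae_sample_mem_box (h : IsRun M ρ γ Γp Γw μ ℱ p w fp fw pbar wbar θ)
    (hM : M.Regular) (hst : StepRules ρ γ) (t : ℕ) (b : Fin B) : ∀ᵐ ω ∂μ, θ t ω b ∈ M.box := by
  have hbox : MeasurableSet M.box := M.isClosed_box.measurableSet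
  have hθ : Measurable fun ω => θ t ω b := (h.measurable_sample t b).mono (ℱ.le _) le_rfl
  have h1 := h.condExp_sample_indicator hM hst t b hbox
  have h2 : ∀ ω, ∑ ν : Fin J → Fin Np, (∏ i, w t ω i (ν i)) *
      M.box.indicator (fun _ => (1 : ℝ)) (jointParticle (p t ω) ν) = 1 := by
    intro ω
    have hx := h.mem hst t ω
    simp only [Set.indicator_of_mem (M.jointParticle_mem_box hx _), mul_one]
    exact sum_prod_eq_one fun j => (hx j).2.1
  simp only [h2] at h1
  have h3 : ∫ ω, ((fun ω => θ t ω b) ⁻¹' M.box).indicator (fun _ => (1 : ℝ)) ω ∂μ = 1 := by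
    rw [← integral_condExp (ℱ.le t), integral_congr_ae h1]
    simp
  rw [integral_indicator (hθ hbox), setIntegral_const, smul_eq_mul, mul_one] at h3
  have h4 : μ ((fun ω => θ t ω b) ⁻¹' M.box) = 1 := by
    rw [Measure.real] at h3
    exact (ENNReal.toReal_eq_one_iff _).1 h3
  exact (prob_compl_eq_zero_iff (hθ hbox)).2 h4

/-- Measurability, boundedness and conditional mean of a function of the iterate and one sample. -/
theorem sample_comp (h : IsRun M ρ γ Γp Γw μ ℱ p w fp fw pbar wbar θ)
    (hM : M.Regular) (hst : StepRules ρ γ) (t : ℕ) (b : Fin B)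
    {g : (Particles J Np × Particles J Np) × (Fin J → ℝ) → ℝ}
    (hg : BddLipOn g (M.feasible Np ×ˢ M.box)) :
    AEStronglyMeasurable[ℱ (t + 1)] (fun ω => g ((p t ω, w t ω), θ t ω b)) μ ∧
      μ[fun ω => g ((p t ω, w t ω), θ t ω b) | ℱ t] =ᵐ[μ] fun ω =>
        ∑ ν : Fin J → Fin Np, (∏ i, w t ω i (ν i)) * g ((p t ω, w t ω), jointParticle (p t ω) ν) := by
  classical
  have hS : MeasurableSet (M.feasible Np ×ˢ M.box) :=
    (M.isClosed_feasible.prod M.isClosed_box).measurableSet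
  -- Nothing is known about `g` off this closed set. Cutting it off gives a bounded Borel function,
  -- and changes its value at the iterate and sample only on a null event.
  set g' := (M.feasible Np ×ˢ M.box).indicator g with hg'
  have hmeas : Measurable g' := by
    rw [hg', ← Set.piecewise_eq_indicator]
    exact hg.continuousOn.measurable_piecewise continuousOn_const hS
  obtain ⟨C, hC, hbd, _⟩ := hg
  have hbd' : ∀ z, |g' z| ≤ C := fun z => by
    by_cases hz : z ∈ M.feasible Np ×ˢ M.box
    · rw [hg', Set.indicator_of_mem hz]; exact hbd z hz
    · rw [hg', Set.indicator_of_notMem hz, abs_zero]; exact hC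
  have hae : (fun ω => g' ((p t ω, w t ω), θ t ω b)) =ᵐ[μ]
      fun ω => g ((p t ω, w t ω), θ t ω b) := by
    filter_upwards [h.ae_sample_mem_box hM hst t b] with ω hω
    exact Set.indicator_of_mem (show ((p t ω, w t ω), θ t ω b) ∈ M.feasible Np ×ˢ M.box from
      ⟨h.mem hst t ω, hω⟩) g
  have hX := h.measurable_iterate t
  refine ⟨AEStronglyMeasurable.congr ?_ hae, ?_⟩
  · refine (Measurable.stronglyMeasurable ?_).aestronglyMeasurable
    exact hmeas.comp ((hX.mono (ℱ.mono t.le_succ) le_rfl).prodMk (h.measurable_sample t b))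
  · have hw : ∀ i n, Measurable[ℱ t] fun ω => w t ω i n := fun i n =>
      (measurable_pi_apply n).comp ((measurable_pi_apply i).comp (h.adapted_w t))
    have hp : ∀ i n, Measurable[ℱ t] fun ω => p t ω i n := fun i n =>
      (measurable_pi_apply n).comp ((measurable_pi_apply i).comp (h.adapted_p t))
    have hpos : ∀ ω i n, 0 ≤ w t ω i n := fun ω i n => (M.weight_pos hM (h.mem hst t ω) i n).le
    have key := condExp_comp_of_finite_law (ℱ.le t) (μ := μ) hX
      ((h.measurable_sample t b).mono (ℱ.le _) le_rfl)
      (W := fun (ν : Fin J → Fin Np) ω => ∏ i, w t ω i (ν i))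
      (fun ν => Finset.measurable_fun_prod _ fun i _ => hw i (ν i))
      (fun ν ω => Finset.prod_nonneg fun i _ => hpos ω i _)
      (fun ν ω => Finset.prod_le_one (fun i _ => hpos ω i _)
        fun i _ => ((h.mem hst t ω i).2.2 _).2)
      (P := fun ν ω => jointParticle (p t ω) ν)
      (fun ν => @measurable_pi_lambda _ _ _ (ℱ t) _ _ fun i => hp i (ν i))
      (fun A hA => h.condExp_sample_indicator hM hst t b hA) hmeas hbd'
    refine (condExp_congr_ae hae.symm).trans (key.trans (Eventually.of_forall fun ω => ?_))
    refine Finset.sum_congr rfl fun ν _ => ?_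
    have hmem : ((p t ω, w t ω), jointParticle (p t ω) ν) ∈ M.feasible Np ×ˢ M.box :=
      ⟨h.mem hst t ω, M.jointParticle_mem_box (h.mem hst t ω) ν⟩
    simp only [hg', Set.indicator_of_mem hmem]

end IsRun

end PSPVBI

namespace PSPVBI

open scoped RealInnerProductSpace

theorem BddLipOn.clm_comp {E F F' : Type*} [NormedAddCommGroup E] [NormedAddCommGroup F]
    [NormedAddCommGroup F'] [NormedSpace ℝ F] [NormedSpace ℝ F'] {s : Set E} {f : E → F}
    (hf : BddLipOn f s) (T : F →L[ℝ] F') : BddLipOn (fun x => T (f x)) s := by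
  obtain ⟨C, hC, h1, h2⟩ := hf
  refine BddLipOn.of_bounds (A := ‖T‖ * C) (B := ‖T‖ * C) (fun x hx => ?_) (fun x hx y hy => ?_)
  · exact (T.le_opNorm _).trans (mul_le_mul_of_nonneg_left (h1 x hx) (norm_nonneg _))
  · rw [← map_sub, mul_assoc]
    exact (T.le_opNorm _).trans (mul_le_mul_of_nonneg_left (h2 x hx y hy) (norm_nonneg _))

theorem aestronglyMeasurable_finsetSum {Ω ι F : Type*} [NormedAddCommGroup F]
    {m mΩ : MeasurableSpace Ω} {μ : Measure Ω} (s : Finset ι) {v : ι → Ω → F}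
    (hv : ∀ i, AEStronglyMeasurable[m] (v i) μ) :
    AEStronglyMeasurable[m] (fun ω => ∑ i ∈ s, v i ω) μ := by
  classical
  induction s using Finset.induction_on with
  | empty => simpa using aestronglyMeasurable_const
  | insert i s hi ih =>
    simp only [Finset.sum_insert hi]
    exact (hv i).add ih

theorem aestronglyMeasurable_euclidean {Ω ι : Type*} [Fintype ι] {m mΩ : MeasurableSpace Ω}
    {μ : Measure Ω} {v : Ω → EuclideanSpace ℝ ι}
    (hv : ∀ i, AEStronglyMeasurable[m] (fun ω => v ω i) μ) : AEStronglyMeasurable[m] v μ := by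
  classical
  have : v = fun ω => ∑ i, v ω i • EuclideanSpace.single i (1 : ℝ) := by
    funext ω
    ext k
    simp [Pi.single_apply]
  rw [this]
  exact aestronglyMeasurable_finsetSum _ fun i => (hv i).smul_const _

/-! ### The algorithm as an averaged gradient run: noise, orthogonality, constants. -/

namespace IsRun

variable {J N Np B : ℕ} {M : Model J N} {ρ γ : ℕ → ℝ} {Γp Γw : ℕ → Fin J → ℝ}
  {Ω : Type*} {mΩ : MeasurableSpace Ω} {μ : Measure Ω} {ℱ : Filtration ℕ mΩ}
  {p w fp fw pbar wbar : ℕ → Ω → Particles J Np} {θ : ℕ → Ω → Fin B → Fin J → ℝ}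

theorem grad_succ_eq (h : IsRun M ρ γ Γp Γw μ ℱ p w fp fw pbar wbar θ) (t : ℕ) (ω : Ω) :
    (fp (t + 1) ω, fw (t + 1) ω) = (1 - ρ t) • (fp t ω, fw t ω)
      + ρ t • ((B : ℝ)⁻¹ • ∑ b, M.sampleGrad ((p t ω, w t ω), θ t ω b)) := by
  ext j n
  · simp only [h.fp_succ, Prod.fst_add, Prod.smul_fst, Prod.fst_sum, Pi.add_apply, Pi.smul_apply,
      Finset.sum_apply, smul_eq_mul, Model.sampleGrad]
    ring
  · simp only [h.fw_succ, Prod.snd_add, Prod.smul_snd, Prod.snd_sum, Pi.add_apply, Pi.smul_apply,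
      Finset.sum_apply, smul_eq_mul, Model.sampleGrad]
    ring

/-- The deviation of the mini-batch gradient from its conditional mean. -/
noncomputable def noise (M : Model J N) (p w : Particles J Np) (θ : Fin B → Fin J → ℝ) :
    EuclideanSpace ℝ ((Fin J × Fin Np) ⊕ (Fin J × Fin Np)) :=
  flatten J Np ((B : ℝ)⁻¹ • ∑ b, M.sampleGrad ((p, w), θ b) - M.meanGrad (p, w))

theorem noise_eq_sum (hB : 0 < B) (p w : Particles J Np) (θ : Fin B → Fin J → ℝ) :
    noise M p w θ = (B : ℝ)⁻¹ • ∑ b, (flatten J Np (M.sampleGrad ((p, w), θ b))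
      - flatten J Np (M.meanGrad (p, w))) := by
  have hB' : (B : ℝ) ≠ 0 := by positivity
  rw [noise, map_sub, map_smul, map_sum, Finset.sum_sub_distrib, Finset.sum_const,
    Finset.card_univ, Fintype.card_fin, smul_sub, ← Nat.cast_smul_eq_nsmul ℝ, smul_smul,
    inv_mul_cancel₀ hB', one_smul]

theorem flatten_meanGrad_apply (x : Particles J Np × Particles J Np)
    (i : (Fin J × Fin Np) ⊕ (Fin J × Fin Np)) :
    flatten J Np (M.meanGrad x) i = ∑ ν : Fin J → Fin Np, (∏ k, x.2 k (ν k)) *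
      flatten J Np (M.sampleGrad (x, jointParticle x.1 ν)) i := by
  rw [M.meanGrad_eq_sum, map_sum, WithLp.ofLp_sum, Finset.sum_apply]
  refine Finset.sum_congr rfl fun ν _ => ?_
  rw [map_smul]
  rfl

theorem bddLipOn_sampleGrad_coord (hM : M.Regular) (i : (Fin J × Fin Np) ⊕ (Fin J × Fin Np)) :
    BddLipOn (fun z => flatten J Np (M.sampleGrad z) i) (M.feasible Np ×ˢ M.box) :=
  hM.bddLipOn_sampleGrad.clm_comp
    ((EuclideanSpace.proj i).comp (flatten J Np).toContinuousLinearMap)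

theorem measurable_meanGrad (h : IsRun M ρ γ Γp Γw μ ℱ p w fp fw pbar wbar θ)
    (hM : M.Regular) (hst : StepRules ρ γ) (t : ℕ) :
    AEStronglyMeasurable[ℱ t] (fun ω => flatten J Np (M.meanGrad (p t ω, w t ω))) μ := by
  have h1 : Measurable[ℱ t] fun ω => flatten J Np (M.meanGrad (p t ω, w t ω)) :=
    measurable_comp_of_continuousOn (m := ℱ t)
      ((flatten J Np).continuous.comp_continuousOn hM.bddLipOn_meanGrad.continuousOn)
      (h.measurable_iterate t) (h.mem hst t)
  exact h1.stronglyMeasurable.aestronglyMeasurable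

variable [IsProbabilityMeasure μ]

theorem ae_bound_sampleGrad (h : IsRun M ρ γ Γp Γw μ ℱ p w fp fw pbar wbar θ)
    (hM : M.Regular) (hst : StepRules ρ γ) :
    ∃ C : ℝ, 0 ≤ C ∧ ∀ t, ∀ᵐ ω ∂μ, ∀ b,
      ‖flatten J Np (M.sampleGrad ((p t ω, w t ω), θ t ω b))‖ ≤ C := by
  obtain ⟨C, hC, h1, _⟩ :=
    (hM.bddLipOn_sampleGrad (Np := Np)).clm_comp (flatten J Np).toContinuousLinearMap
  refine ⟨C, hC, fun t => ?_⟩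
  have := ae_all_iff.2 fun b => h.ae_sample_mem_box hM hst t b
  filter_upwards [this] with ω hω b
  exact h1 _ ⟨h.mem hst t ω, hω b⟩

theorem measurable_sampleGrad (h : IsRun M ρ γ Γp Γw μ ℱ p w fp fw pbar wbar θ)
    (hM : M.Regular) (hst : StepRules ρ γ) (t : ℕ) (b : Fin B) :
    AEStronglyMeasurable[ℱ (t + 1)]
      (fun ω => flatten J Np (M.sampleGrad ((p t ω, w t ω), θ t ω b))) μ :=
  aestronglyMeasurable_euclidean fun i =>
    (h.sample_comp hM hst t b (bddLipOn_sampleGrad_coord hM i)).1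

/-- The averaged gradients are adapted (up to null sets) and bounded at every time. -/
theorem averaged_grad_adapted (h : IsRun M ρ γ Γp Γw μ ℱ p w fp fw pbar wbar θ)
    (hM : M.Regular) (hst : StepRules ρ γ) (t : ℕ) :
    AEStronglyMeasurable[ℱ t] (fun ω => flatten J Np (fp t ω, fw t ω)) μ ∧
      ∃ A : ℝ, ∀ᵐ ω ∂μ, ‖flatten J Np (fp t ω, fw t ω)‖ ≤ A := by
  induction t with
  | zero =>
    have h0 : ∀ ω, flatten J Np (fp 0 ω, fw 0 ω) = 0 := fun ω => by
      rw [h.fp_zero, h.fw_zero]; exact map_zero _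
    simp only [h0]
    exact ⟨aestronglyMeasurable_const, 0, by simp⟩
  | succ t ih =>
    obtain ⟨ih1, A, ih2⟩ := ih
    have hsucc : ∀ ω, flatten J Np (fp (t + 1) ω, fw (t + 1) ω)
        = (1 - ρ t) • flatten J Np (fp t ω, fw t ω)
          + ρ t • ((B : ℝ)⁻¹ • ∑ b, flatten J Np (M.sampleGrad ((p t ω, w t ω), θ t ω b))) :=
      fun ω => by
        rw [h.grad_succ_eq, map_add, map_smul, map_smul, map_smul, map_sum]
    simp only [hsucc]
    refine ⟨?_, ?_⟩
    · have hsum : AEStronglyMeasurable[ℱ (t + 1)] (fun ω => ∑ b, flatten J Np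
          (M.sampleGrad ((p t ω, w t ω), θ t ω b))) μ :=
        aestronglyMeasurable_finsetSum _ fun b => h.measurable_sampleGrad hM hst t b
      have hold := ih1.mono (ℱ.mono t.le_succ)
      exact (hold.const_smul (1 - ρ t)).add ((hsum.const_smul (B : ℝ)⁻¹).const_smul (ρ t))
    · obtain ⟨C, hC, hbd⟩ := h.ae_bound_sampleGrad hM hst
      refine ⟨‖1 - ρ t‖ * A + ‖ρ t‖ * (‖(B : ℝ)⁻¹‖ * ∑ _ : Fin B, C), ?_⟩
      filter_upwards [ih2, hbd t] with ω h1 h2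
      refine (norm_add_le _ _).trans ?_
      rw [norm_smul, norm_smul, norm_smul]
      have h3 : ‖∑ b, flatten J Np (M.sampleGrad ((p t ω, w t ω), θ t ω b))‖ ≤ ∑ _ : Fin B, C :=
        norm_sum_le_of_le _ fun b _ => h2 b
      gcongr

/-- A factor known at time `t` is pulled out of the conditional expectation, which for the sample
equals the subtracted mean. -/
theorem integral_mul_sample_sub_mean (h : IsRun M ρ γ Γp Γw μ ℱ p w fp fw pbar wbar θ)
    (hM : M.Regular) (hst : StepRules ρ γ) (t : ℕ) (b : Fin B)
    {g : (Particles J Np × Particles J Np) × (Fin J → ℝ) → ℝ}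
    (hg : BddLipOn g (M.feasible Np ×ˢ M.box)) {Z : Ω → ℝ} (hZ : AEStronglyMeasurable[ℱ t] Z μ)
    {A : ℝ} (hA : ∀ᵐ ω ∂μ, |Z ω| ≤ A) :
    Integrable (fun ω => Z ω * (g ((p t ω, w t ω), θ t ω b) - ∑ ν : Fin J → Fin Np,
      (∏ i, w t ω i (ν i)) * g ((p t ω, w t ω), jointParticle (p t ω) ν))) μ ∧
    ∫ ω, Z ω * (g ((p t ω, w t ω), θ t ω b) - ∑ ν : Fin J → Fin Np,
      (∏ i, w t ω i (ν i)) * g ((p t ω, w t ω), jointParticle (p t ω) ν)) ∂μ = 0 := by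
  obtain ⟨h1, h2⟩ := h.sample_comp hM hst t b hg
  obtain ⟨C, hC, hbd, _⟩ := hg
  have hgb : ∀ᵐ ω ∂μ, ‖g ((p t ω, w t ω), θ t ω b)‖ ≤ C := by
    filter_upwards [h.ae_sample_mem_box hM hst t b] with ω hω
    exact hbd _ ⟨h.mem hst t ω, hω⟩
  have ig : Integrable (fun ω => g ((p t ω, w t ω), θ t ω b)) μ :=
    Integrable.of_bound (h1.mono (ℱ.le _)) C hgb
  have iZg : Integrable (Z * fun ω => g ((p t ω, w t ω), θ t ω b)) μ := by
    refine Integrable.of_bound ((hZ.mono (ℱ.le t)).mul (h1.mono (ℱ.le _))) (A * C) ?_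
    filter_upwards [hA, hgb] with ω k1 k2
    rw [Pi.mul_apply, norm_mul]
    exact mul_le_mul k1 k2 (norm_nonneg _) ((abs_nonneg _).trans k1)
  have hce := (condExp_mul_of_aestronglyMeasurable_left hZ iZg ig).trans
    ((EventuallyEq.refl _ Z).mul h2)
  have iZm := (integrable_condExp (m := ℱ t)
    (f := Z * fun ω => g ((p t ω, w t ω), θ t ω b)) (μ := μ)).congr hce
  have heq : (fun ω => Z ω * (g ((p t ω, w t ω), θ t ω b) - ∑ ν : Fin J → Fin Np,
      (∏ i, w t ω i (ν i)) * g ((p t ω, w t ω), jointParticle (p t ω) ν)))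
      = (Z * fun ω => g ((p t ω, w t ω), θ t ω b)) - (Z * fun ω => ∑ ν : Fin J → Fin Np,
        (∏ i, w t ω i (ν i)) * g ((p t ω, w t ω), jointParticle (p t ω) ν)) := by
    funext ω
    simp only [Pi.sub_apply, Pi.mul_apply, mul_sub]
  rw [heq]
  refine ⟨iZg.sub iZm, ?_⟩
  rw [integral_sub' iZg iZm, ← integral_condExp (ℱ.le t), integral_congr_ae hce]
  exact sub_self _

/-- The average `fp t`, `fw t` contains only batches before the `t`-th, so the tracking error is
known when that batch is drawn. The inner product is then treated coordinate by coordinate and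
sample by sample. -/
theorem integral_inner_noise (hB : 0 < B) (h : IsRun M ρ γ Γp Γw μ ℱ p w fp fw pbar wbar θ)
    (hM : M.Regular) (hst : StepRules ρ γ) (t : ℕ) :
    ∫ ω, ⟪flatten J Np (fp t ω, fw t ω) - flatten J Np (M.meanGrad (p t ω, w t ω)),
      noise M (p t ω) (w t ω) (θ t ω)⟫ ∂μ = 0 := by
  obtain ⟨hf, A, hA⟩ := h.averaged_grad_adapted hM hst t
  obtain ⟨C, hC, hG, _⟩ :=
    (hM.bddLipOn_meanGrad (Np := Np)).clm_comp (flatten J Np).toContinuousLinearMap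
  set d : Ω → EuclideanSpace ℝ ((Fin J × Fin Np) ⊕ (Fin J × Fin Np)) := fun ω =>
    flatten J Np (fp t ω, fw t ω) - flatten J Np (M.meanGrad (p t ω, w t ω))
  have hdm : AEStronglyMeasurable[ℱ t] d μ := hf.sub (h.measurable_meanGrad hM hst t)
  have hdb : ∀ᵐ ω ∂μ, ‖d ω‖ ≤ A + C := by
    filter_upwards [hA] with ω hω
    exact (norm_sub_le _ _).trans (add_le_add hω (hG _ (h.mem hst t ω)))
  change ∫ ω, ⟪d ω, noise M (p t ω) (w t ω) (θ t ω)⟫ ∂μ = 0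
  clear_value d
  have hterm := fun b i => h.integral_mul_sample_sub_mean hM hst t b
    (bddLipOn_sampleGrad_coord hM i) (Z := fun ω => d ω i)
    ((EuclideanSpace.proj (𝕜 := ℝ) i).continuous.comp_aestronglyMeasurable hdm)
    (A := A + C) (hdb.mono fun ω hω => (PiLp.norm_apply_le (d ω) i).trans hω)
  have hexp : ∀ ω, ⟪d ω, noise M (p t ω) (w t ω) (θ t ω)⟫ = (B : ℝ)⁻¹ * ∑ b, ∑ i,
      d ω i * (flatten J Np (M.sampleGrad ((p t ω, w t ω), θ t ω b)) i
        - ∑ ν : Fin J → Fin Np, (∏ k, w t ω k (ν k)) *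
          flatten J Np (M.sampleGrad ((p t ω, w t ω), jointParticle (p t ω) ν)) i) := by
    intro ω
    rw [noise_eq_sum hB, real_inner_smul_right, inner_sum]
    congr 1
    refine Finset.sum_congr rfl fun b _ => ?_
    rw [PiLp.inner_apply]
    refine Finset.sum_congr rfl fun i _ => ?_
    rw [PiLp.sub_apply, flatten_meanGrad_apply]
    exact mul_comm (_ : ℝ) _
  rw [integral_congr_ae (Eventually.of_forall hexp)]
  rw [integral_const_mul, integral_finsetSum _ fun b _ =>
    integrable_finsetSum _ fun i _ => (hterm b i).1]
  rw [Finset.sum_eq_zero, mul_zero]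
  intro b _
  rw [integral_finsetSum _ fun i _ => (hterm b i).1]
  exact Finset.sum_eq_zero fun i _ => (hterm b i).2

theorem exists_ae_bound_noise (h : IsRun M ρ γ Γp Γw μ ℱ p w fp fw pbar wbar θ)
    (hM : M.Regular) (hst : StepRules ρ γ) :
    ∃ C : ℝ, 0 ≤ C ∧ ∀ t, ∀ᵐ ω ∂μ, ‖noise M (p t ω) (w t ω) (θ t ω)‖ ≤ C := by
  obtain ⟨C, hC, hbd⟩ := h.ae_bound_sampleGrad hM hst
  obtain ⟨D, hD, hG, _⟩ :=
    (hM.bddLipOn_meanGrad (Np := Np)).clm_comp (flatten J Np).toContinuousLinearMap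
  refine ⟨‖(B : ℝ)⁻¹‖ * ∑ _ : Fin B, C + D, by positivity, fun t => ?_⟩
  filter_upwards [hbd t] with ω hω
  rw [noise, map_sub, map_smul, map_sum]
  refine (norm_sub_le _ _).trans (add_le_add ?_ (hG _ (h.mem hst t ω)))
  rw [norm_smul]
  exact mul_le_mul_of_nonneg_left (norm_sum_le_of_le _ fun b _ => hω b) (norm_nonneg _)

/-- The run of the algorithm, seen in Euclidean space. -/
theorem exists_averagedGradientRun (hB : 0 < B)
    (h : IsRun M ρ γ Γp Γw μ ℱ p w fp fw pbar wbar θ) (hM : M.Regular) (hst : StepRules ρ γ)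
    {Γmin Γmax : ℝ} (hΓmin : 0 < Γmin) (hΓp : ∀ t j, Γp t j ∈ Set.Icc Γmin Γmax)
    (hΓw : ∀ t j, Γw t j ∈ Set.Icc Γmin Γmax) :
    ∃ c C : ℝ, AveragedGradientRun ((flatten J Np).symm ⁻¹' M.feasible Np)
      (fun v => M.objective ((flatten J Np).symm v))
      (fun v => flatten J Np (M.meanGrad ((flatten J Np).symm v))) c C ρ γ μ
      (fun t ω => flatten J Np (p t ω, w t ω)) (fun t ω => flatten J Np (fp t ω, fw t ω))
      (fun t ω => flatten J Np (pbar t ω, wbar t ω))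
      (fun t ω => noise M (p t ω) (w t ω) (θ t ω)) := by
  set Φ := flatten J Np with hΦ
  have hsymm : ∀ v, ‖Φ.symm v‖ ≤ ‖Φ.symm.toContinuousLinearMap‖ * ‖v‖ :=
    Φ.symm.toContinuousLinearMap.le_opNorm
  set S := ‖Φ.symm.toContinuousLinearMap‖
  have hS : 0 ≤ S := norm_nonneg _
  obtain ⟨C₁, hC₁, hup⟩ := hM.exists_objective_upper_bound (Np := Np)
  obtain ⟨C₂, hC₂, hGb, hGl⟩ := (hM.bddLipOn_meanGrad (Np := Np)).clm_comp Φ.toContinuousLinearMap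
  obtain ⟨C₃, hC₃, hLb, _⟩ := hM.bddLipOn_objective (Np := Np)
  obtain ⟨C₄, hC₄, hIb, _⟩ := (hM.bddLipOn_id (Np := Np)).clm_comp Φ.toContinuousLinearMap
  obtain ⟨C₅, hC₅, hnb⟩ := h.exists_ae_bound_noise hM hst
  have hdiam : ∀ u ∈ Φ.symm ⁻¹' M.feasible Np, ∀ v ∈ Φ.symm ⁻¹' M.feasible Np,
      ‖u - v‖ ≤ C₄ + C₄ := by
    intro u hu v hv
    have h1 := hIb _ hu
    have h2 := hIb _ hv
    simp only [ContinuousLinearEquiv.coe_coe, ContinuousLinearEquiv.apply_symm_apply] at h1 h2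
    exact (norm_sub_le _ _).trans (add_le_add h1 h2)
  -- Optimality constant: `sum_step_le_of_bound` with diameter `C₄ + C₄`, summed over the `J`
  -- unknowns, once for positions and once for weights.
  set C₆ := 2 * (J * (Γmin⁻¹ * (Np * (C₄ + C₄)))) with hC₆
  have hC₆0 : 0 ≤ C₆ := by positivity
  have hmem : ∀ t ω, Φ.symm (Φ (p t ω, w t ω)) ∈ M.feasible Np := fun t ω => by
    rw [Φ.symm_apply_apply]; exact h.mem hst t ω
  have hmem' : ∀ t ω, Φ.symm (Φ (pbar t ω, wbar t ω)) ∈ M.feasible Np := fun t ω => by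
    rw [Φ.symm_apply_apply]; exact h.bar_mem t ω
  -- If `J = 0` the step-length bounds are vacuous and `Γmax` may fail to be positive; the maximum
  -- keeps the descent constant positive.
  have hΓ' : 0 < max Γmin Γmax := lt_max_of_lt_left hΓmin
  set C := C₁ * S ^ 2 + C₂ * S + C₂ + C₃ + (C₄ + C₄) + C₅ + C₆ with hCdef
  have p1 : 0 ≤ C₁ * S ^ 2 := by positivity
  have p2 : 0 ≤ C₂ * S := by positivity
  refine ⟨(max Γmin Γmax)⁻¹, C, ?_⟩
  refine
    { pos := by positivity
      nonneg := by positivity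
      upper := fun u hu v hv => ?_
      lip := fun u hu v hv => ?_
      bound_grad := fun u hu => (hGb _ hu).trans (by linarith)
      bound_obj := fun u hu => (hLb _ hu).trans (by linarith)
      diam := fun u hu v hv => (hdiam u hu v hv).trans (by linarith)
      mem := hmem
      mem_bar := hmem'
      x_succ := fun t ω => by rw [h.succ_eq, map_add, map_smul, map_sub]
      f_zero := fun ω => by rw [h.fp_zero, h.fw_zero]; exact map_zero _
      f_succ := fun t ω => ?_
      bound_noise := fun t => (hnb t).mono fun ω hω => hω.trans (by linarith)
      descent := fun t ω => ?_
      optimality := fun t ω v hv => ?_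
      meas_x := fun t => ?_
      meas_obj := fun t => ?_
      meas_grad := fun t => ?_
      meas_noise := fun t => ?_
      orthogonal := fun t => ?_ }
  · have h1 := hup _ hu _ hv
    rw [pairing_apply, ← map_sub, ← hΦ, Φ.apply_symm_apply] at h1
    refine h1.trans (add_le_add le_rfl ?_)
    calc C₁ * ‖Φ.symm (v - u)‖ ^ 2 ≤ C₁ * (S * ‖v - u‖) ^ 2 := by
          gcongr; exact hsymm _
      _ = C₁ * S ^ 2 * ‖v - u‖ ^ 2 := by ring
      _ ≤ C * ‖v - u‖ ^ 2 := by gcongr; linarith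
  · refine (hGl _ hu _ hv).trans ?_
    rw [← map_sub]
    calc C₂ * ‖Φ.symm (u - v)‖ ≤ C₂ * (S * ‖u - v‖) := by gcongr; exact hsymm _
      _ = C₂ * S * ‖u - v‖ := by ring
      _ ≤ C * ‖u - v‖ := by gcongr; linarith
  · rw [h.grad_succ_eq, noise, map_add, map_smul, map_smul, Φ.symm_apply_apply, ← hΦ, map_sub,
      add_sub_cancel]
  · rw [← map_sub, ← real_inner_self_eq_norm_sq, inner_flatten, inner_flatten, mul_add,
      Finset.mul_sum, Finset.mul_sum]
    refine add_le_add (Finset.sum_le_sum fun j _ => ?_) (Finset.sum_le_sum fun j _ => ?_)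
    · exact (h.pbar_proj t ω j).sum_step_self_le (M.convex_posSet j) (hΓmin.trans_le (hΓp t j).1)
        ((hΓp t j).2.trans (le_max_right _ _)) (h.mem hst t ω j).1
    · exact (h.wbar_proj t ω j).sum_step_self_le M.convex_weightSet (hΓmin.trans_le (hΓw t j).1)
        ((hΓw t j).2.trans (le_max_right _ _)) (h.mem hst t ω j).2
  · obtain ⟨y, rfl⟩ := Φ.surjective v
    have hy : y ∈ M.feasible Np := by simpa using hv
    have hD := hdiam _ (hmem' t ω) _ hv
    rw [← map_sub] at hD ⊢
    rw [← map_sub]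
    have b1 := PiLp.norm_apply_le (Φ ((pbar t ω, wbar t ω) - (p t ω, w t ω)))
    have b2 := fun i => (PiLp.norm_apply_le (Φ ((pbar t ω, wbar t ω) - y)) i).trans hD
    set a := ‖Φ ((pbar t ω, wbar t ω) - (p t ω, w t ω))‖
    rw [inner_flatten]
    have k1 : ∀ j, ∑ n, fp (t + 1) ω j n * (pbar t ω j n - y.1 j n)
        ≤ Γmin⁻¹ * (Np * (a * (C₄ + C₄))) := fun j =>
      (h.pbar_proj t ω j).sum_step_le_of_bound (M.convex_posSet j) hΓmin (hΓp t j).1 (hy j).1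
        (fun n => b1 (Sum.inl (j, n))) (fun n => b2 (Sum.inl (j, n)))
    have k2 : ∀ j, ∑ n, fw (t + 1) ω j n * (wbar t ω j n - y.2 j n)
        ≤ Γmin⁻¹ * (Np * (a * (C₄ + C₄))) := fun j =>
      (h.wbar_proj t ω j).sum_step_le_of_bound M.convex_weightSet hΓmin (hΓw t j).1 (hy j).2
        (fun n => b1 (Sum.inr (j, n))) (fun n => b2 (Sum.inr (j, n)))
    have s1 := Finset.sum_le_sum fun j (_ : j ∈ Finset.univ) => k1 j
    have s2 := Finset.sum_le_sum fun j (_ : j ∈ Finset.univ) => k2 j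
    rw [Finset.sum_const, Finset.card_univ, Fintype.card_fin, nsmul_eq_mul] at s1 s2
    have ha : 0 ≤ a := norm_nonneg _
    calc _ ≤ (J : ℝ) * (Γmin⁻¹ * (Np * (a * (C₄ + C₄))))
          + J * (Γmin⁻¹ * (Np * (a * (C₄ + C₄)))) := add_le_add s1 s2
      _ = C₆ * a := by rw [hC₆]; ring
      _ ≤ C * a := by gcongr; linarith
  · exact (Φ.continuous.measurable.comp ((h.measurable_iterate t).mono (ℱ.le t)
      le_rfl)).stronglyMeasurable.aestronglyMeasurable
  · simp only [Φ.symm_apply_apply]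
    exact (measurable_comp_of_continuousOn hM.bddLipOn_objective.continuousOn
      ((h.measurable_iterate t).mono (ℱ.le t) le_rfl)
      (h.mem hst t)).stronglyMeasurable.aestronglyMeasurable
  · simp only [Φ.symm_apply_apply]
    exact (h.measurable_meanGrad hM hst t).mono (ℱ.le t)
  · simp only [noise_eq_sum hB]
    refine AEStronglyMeasurable.const_smul (aestronglyMeasurable_finsetSum _ fun b => ?_) (B : ℝ)⁻¹
    exact ((h.measurable_sampleGrad hM hst t b).mono (ℱ.le _)).sub
      ((h.measurable_meanGrad hM hst t).mono (ℱ.le t))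
  · simp only [Φ.symm_apply_apply]
    exact h.integral_inner_noise hB hM hst t

end IsRun

end PSPVBI

/-! ### Transfer of the first-order condition back to positions and weights. -/

theorem theorem1 {J N Np B : ℕ} (hB : 0 < B) (M : PSPVBI.Model J N) (hM : M.Regular)
    (ρ γ : ℕ → ℝ) (hstep : PSPVBI.StepRules ρ γ)
    (Γp Γw : ℕ → Fin J → ℝ) (Γmin Γmax : ℝ) (hΓmin : 0 < Γmin)
    (hΓp : ∀ t j, Γp t j ∈ Set.Icc Γmin Γmax) (hΓw : ∀ t j, Γw t j ∈ Set.Icc Γmin Γmax)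
    {Ω : Type*} {mΩ : MeasurableSpace Ω} (μ : Measure Ω) [IsProbabilityMeasure μ]
    (ℱ : Filtration ℕ mΩ)
    (p w fp fw pbar wbar : ℕ → Ω → PSPVBI.Particles J Np)
    (θ : ℕ → Ω → Fin B → Fin J → ℝ)
    (hrun : PSPVBI.IsRun M ρ γ Γp Γw μ ℱ p w fp fw pbar wbar θ) :
    ∀ᵐ ω ∂μ, ∀ x : PSPVBI.Particles J Np × PSPVBI.Particles J Np,
      MapClusterPt x atTop (fun t => (p t ω, w t ω)) → M.IsStationary x := by
  obtain ⟨c, C, h⟩ := hrun.exists_averagedGradientRun hB hM hstep hΓmin hΓp hΓw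
  filter_upwards [h.ae_forall_limit_point hstep] with ω hω x hx
  have hxK : x ∈ M.feasible Np :=
    M.isClosed_feasible.mem_of_mapClusterPt hx (Eventually.of_forall fun t => hrun.mem hstep t ω)
  refine ⟨hxK, PSPVBI.pairing (M.meanGrad x), hM.hasFDerivWithinAt_objective hxK, fun y hy => ?_⟩
  have hcl : MapClusterPt (PSPVBI.flatten J Np x) atTop
      (fun t => PSPVBI.flatten J Np (p t ω, w t ω)) :=
    hx.continuousAt_comp (PSPVBI.flatten J Np).continuous.continuousAt
  have := hω (PSPVBI.flatten J Np x) (by simpa using hxK) hcl (PSPVBI.flatten J Np y)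
    (by simpa using hy)
  rwa [ContinuousLinearEquiv.symm_apply_apply, ← map_sub] at this
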